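/- **Setting.** An *Euler integrand* in $n$ variables is a function $\mathcal I(\alpha;\epsilon)=\alpha^{\nu(\epsilon)}\prod_{j=1}^m P_j(\alpha)^{c_j(\epsilon)}$, $\alpha\in\mathbb R_{>0}^n$, where the $P_j$ are nonzero Laurent polynomials with non-negative real coefficients and the complex exponents $\nu(\epsilon)=\nu_0+\epsilon\nu_1\in\mathbb C^n$, $c_j(\epsilon)=c_{j,0}+\epsilon c_{j,1}\in\mathbb C$ are affine in $\epsilon$. Its Newton polytope $\mathrm{Newt}\,\mathcal I$ is the convex hull of the exponents of $\prod_jP_j$. For a polytope $Q$, the normal fan $\mathrm{Fan}\,Q$ consists of the cones $\sigma_F=\{\rho:\rho\cdot z\text{ is maximized over }Q\text{ at all points of }F\}$, $F$ a nonempty face of $Q$. The common refinement of finitely many fans consists of all intersections of cones, one from each fan; $\Sigma(1)$ is the set of one-dimensional cones of a fan $\Sigma$. For $\rho\in\mathbb Z^n$ put $\mathrm{Trop}\,P_j(\rho)=\max\{\rho\cdot m: m \text{ an exponent of }P_j\}$ and $\mathrm{Trop}\,\mathcal I(\rho)=\nu(\epsilon)\cdot\rho+\sum_jc_j(\epsilon)\,\mathrm{Trop}\,P_j(\rho)$.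 Then $\lambda^{\mathrm{Trop}\,\mathcal I(\rho)}\,\mathcal I(\alpha\lambda^{-\rho};\epsilon)$, where $(\alpha\lambda^{-\rho})_i=\alpha_i\lambda^{-\rho_i}$, extends smoothly to $\lambda=0$; let $\sum_{k\ge0}\phi_k(\alpha;\epsilon)\lambda^k$ be its Taylor series there, and $\tau_\rho\mathcal I=\sum_k\phi_k\,\lambda^{k-\mathrm{Trop}\,\mathcal I(\rho)}$. For a finite linear combination $\mathcal I=\sum_i s_i\mathcal I_i$ with constants $s_i\in\mathbb C$, put $\tau_\rho\mathcal I=\sum_is_i\,\tau_\rho\mathcal I_i$, terms being collected when their exponents agree as affine functions of $\epsilon$. $\mathrm{Trop}\,\mathcal I(\rho)$ is minus the exponent of the leading term of $\tau_\rho\mathcal I$, that is, for real $\epsilon$, the maximum of $\mathrm{Re}(a+b\epsilon)$ over the powers $\lambda^{-(a+b\epsilon)}$ whose collected coefficient is not identically zero in $(\alpha,\epsilon)$, and $-\infty$ if there are none. We write $\mathrm{Trop}\,\mathcal I(\rho)=a+\mathcal O(\epsilon)$ for the behaviour as $\epsilon\to0$; the value $-\infty$ counts as having $a<0$. $\mathcal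 I$ is *locally finite* if, with $\frac{d\alpha}{\alpha}=\prod_i\frac{d\alpha_i}{\alpha_i}$, the integral $\int_{\mathbb R_{>0}^n}\frac{d\alpha}{\alpha}\mathcal I$ converges absolutely for all complex $\epsilon$ near $0$ and is analytic at $\epsilon=0$, and for every $k\ge0$ the integral $\int\frac{d\alpha}{\alpha}\,\partial_\epsilon^k\mathcal I|_{\epsilon=0}$ converges absolutely and equals $\partial_\epsilon^k|_{\epsilon=0}\int\frac{d\alpha}{\alpha}\,\mathcal I$; i.e. integration and Taylor expansion in $\epsilon$ commute. **Theorem.** Let $\mathcal I=\sum_i s_i\mathcal I_i$ be a finite linear combination of Euler integrands and let $\Sigma$ be the common refinement of the fans $\Sigma_i=\mathrm{Fan}\,\mathrm{Newt}\,\mathcal I_i$. Assume that $\Sigma$ is pointed (no cone of $\Sigma$ contains a line). Then $\Sigma(1)$ is finite, and if for every ray in $\Sigma(1)$ and every nonzero integer vector $\rho$ on it $\mathrm{Trop}\,\mathcal I(\rho)=a+\mathcal O(\epsilon)$ with $a<0$, then $\mathcal I$ is locally finite. -/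

import Mathlib

open Filter Topology MeasureTheory Matrix

noncomputable section

namespace EulerInt

/-- Laurent polynomials in `n` variables with real coefficients: finite formal sums
`∑ s_m α^m`, `m ∈ ℤⁿ`. -/
abbrev Laurent (n : ℕ) := AddMonoidAlgebra ℝ (Fin n → ℤ)

/-- The value `P(α) = ∑ s_m α_1^{m_1} ⋯ α_n^{m_n}`. -/
def Laurent.eval {n : ℕ} (P : Laurent n) (α : Fin n → ℝ) : ℝ :=
  P.coeff.sum fun m s => s * ∏ i, α i ^ m i

/-- The Newton polytope: the convex hull of the exponents of `P`. -/
def newton {n : ℕ} (P : Laurent n) : Set (Fin n → ℝ) :=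
  convexHull ℝ ((fun (m : Fin n → ℤ) (i : Fin n) => (m i : ℝ)) '' (P.coeff.support : Set (Fin n → ℤ)))

/-- The cone `σ_F` of functionals `ρ` such that `ρ · z` is maximized over `Q` at (all of) `F`. -/
def normalCone {n : ℕ} (Q F : Set (Fin n → ℝ)) : PointedCone ℝ (Fin n → ℝ) where
  carrier := {ρ | ∀ z ∈ F, ∀ y ∈ Q, ρ ⬝ᵥ y ≤ ρ ⬝ᵥ z}
  add_mem' := by
    intro a b ha hb z hz y hy
    rw [add_dotProduct, add_dotProduct]
    exact add_le_add (ha z hz y hy) (hb z hz y hy)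
  zero_mem' := by
    intro z _ y _
    simp
  smul_mem' := by
    intro c x hx z hz y hy
    have h : (c • x : Fin n → ℝ) = (c : ℝ) • x := rfl
    rw [h, smul_dotProduct, smul_dotProduct]
    exact mul_le_mul_of_nonneg_left (hx z hz y hy) c.2

/-- The normal fan of a polytope: the cones `σ_F`, one for each nonempty face `F`. -/
def normalFan {n : ℕ} (Q : Set (Fin n → ℝ)) : Set (PointedCone ℝ (Fin n → ℝ)) :=
  {σ | ∃ F : Set (Fin n → ℝ), F.Nonempty ∧ IsExposed ℝ Q F ∧ σ = normalCone Q F}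

/-- The common refinement of a family of fans: all intersections of cones, one from each fan. -/
def commonRefinement {n : ℕ} {ι : Type*} (S : ι → Set (PointedCone ℝ (Fin n → ℝ))) :
    Set (PointedCone ℝ (Fin n → ℝ)) :=
  {σ | ∃ τ : ι → PointedCone ℝ (Fin n → ℝ), (∀ i, τ i ∈ S i) ∧ σ = ⨅ i, τ i}

/-- The dimension of a cone. -/
def coneDim {n : ℕ} (σ : PointedCone ℝ (Fin n → ℝ)) : ℕ :=
  Module.finrank ℝ (Submodule.span ℝ (σ : Set (Fin n → ℝ)))

/-- `Σ(m)`: the cones of dimension `m` of a fan. -/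
def fanDim {n : ℕ} (S : Set (PointedCone ℝ (Fin n → ℝ))) (m : ℕ) :
    Set (PointedCone ℝ (Fin n → ℝ)) :=
  {σ ∈ S | coneDim σ = m}

/-- A fan is pointed if none of its cones contains a line. -/
def FanPointed {n : ℕ} (S : Set (PointedCone ℝ (Fin n → ℝ))) : Prop :=
  ∀ σ ∈ S, (σ : ConvexCone ℝ (Fin n → ℝ)).Salient

/-- An Euler integrand `α^{ν(ε)} ∏_j P_j(α)^{c_j(ε)}`, where the `P_j` are nonzero Laurent
polynomials with nonnegative coefficients and the exponents
`ν(ε) = ν₀ + ε ν₁`, `c_j(ε) = c₀ j + ε c₁ j` are affine in `ε`. -/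
structure EulerIntegrand (n : ℕ) where
  m : ℕ
  ν₀ : Fin n → ℂ
  ν₁ : Fin n → ℂ
  P : Fin m → Laurent n
  c₀ : Fin m → ℂ
  c₁ : Fin m → ℂ
  P_ne_zero : ∀ j, P j ≠ 0
  P_nonneg : ∀ j k, 0 ≤ (P j).coeff k

namespace EulerIntegrand

variable {n : ℕ}

/-- The monomial prefactor `α^{ν(ε)}`. -/
def monomial (I : EulerIntegrand n) (ε : ℂ) (α : Fin n → ℝ) : ℂ :=
  ∏ i, (α i : ℂ) ^ (I.ν₀ i + ε * I.ν₁ i)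

/-- The value of the integrand at `ε` and `α` (meaningful for `α` in the positive orthant). -/
def eval (I : EulerIntegrand n) (ε : ℂ) (α : Fin n → ℝ) : ℂ :=
  I.monomial ε α * ∏ j, (((I.P j).eval α : ℝ) : ℂ) ^ (I.c₀ j + ε * I.c₁ j)

/-- The Newton polytope of the integrand: that of the product of its polynomials. -/
def newt (I : EulerIntegrand n) : Set (Fin n → ℝ) := newton (∏ j, I.P j)

/-- `Trop P_j (ρ)`: the maximum of `ρ · m` over the exponents `m` of `P_j`. -/
def tropPoly (I : EulerIntegrand n) (ρ : Fin n → ℤ) (j : Fin I.m) : ℤ :=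
  (I.P j).coeff.support.sup'
    (Finsupp.support_nonempty_iff.2 fun h => I.P_ne_zero j (by
      ext k
      simp [h]))
    fun m => ρ ⬝ᵥ m

/-- The constant term of `Trop I (ρ) = ν(ε) · ρ + ∑ c_j(ε) Trop P_j (ρ)`, which is affine in `ε`. -/
def tropConst (I : EulerIntegrand n) (ρ : Fin n → ℤ) : ℂ :=
  (∑ i, I.ν₀ i * (ρ i : ℂ)) + ∑ j, I.c₀ j * (I.tropPoly ρ j : ℂ)

/-- The coefficient of `ε` in `Trop I (ρ)`. -/
def tropSlope (I : EulerIntegrand n) (ρ : Fin n → ℤ) : ℂ :=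
  (∑ i, I.ν₁ i * (ρ i : ℂ)) + ∑ j, I.c₁ j * (I.tropPoly ρ j : ℂ)

/-- The polynomial in `t` given, for `t > 0`, by `t^{Trop P_j (ρ)} P_j(α t^{-ρ})`. -/
def rescaledPoly (I : EulerIntegrand n) (ρ : Fin n → ℤ) (j : Fin I.m) (α : Fin n → ℝ) (t : ℝ) : ℝ :=
  (I.P j).coeff.sum fun m s => s * (∏ i, α i ^ m i) * t ^ (I.tropPoly ρ j - ρ ⬝ᵥ m).toNat

/-- The rescaled integrand with its leading power stripped: for `t > 0` this is
`t^{Trop I (ρ)} I(α t^{-ρ})`. It is a smooth function of `t` near `t = 0` for positive `α`. -/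
def rescaled (I : EulerIntegrand n) (ρ : Fin n → ℤ) (ε : ℂ) (α : Fin n → ℝ) (t : ℝ) : ℂ :=
  I.monomial ε α * ∏ j, ((I.rescaledPoly ρ j α t : ℝ) : ℂ) ^ (I.c₀ j + ε * I.c₁ j)

/-- The coefficient of `t^k` in the Taylor series at `t = 0` of the stripped rescaled integrand,
that is the coefficient of `t^{k - Trop I (ρ)}` in the Puiseux series `τ_ρ I`. -/
def taylorCoeff (I : EulerIntegrand n) (ρ : Fin n → ℤ) (k : ℕ) (ε : ℂ) (α : Fin n → ℝ) : ℂ :=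
  iteratedDeriv k (I.rescaled ρ ε α) 0 / (k.factorial : ℂ)

end EulerIntegrand

variable {n : ℕ} {ι : Type*} [Fintype ι]

/-- The value of the combination `∑ i, s i • I i`. -/
def combEval (s : ι → ℂ) (I : ι → EulerIntegrand n) (ε : ℂ) (α : Fin n → ℝ) : ℂ :=
  ∑ i, s i * (I i).eval ε α

/-- The coefficient (a function of `ε` and `α`) of `t^{-(a + b ε)}` in the Puiseux series
`τ_ρ (∑ i, s i • I i) = ∑ i, s i • ∑ k, (coefficient) t^{k - Trop (I i) (ρ)}`. The exponents are
affine functions of `ε`; each `I i` contributes to the exponent `-(a + b ε)` at most once. -/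
def puiseuxCoeff (s : ι → ℂ) (I : ι → EulerIntegrand n) (ρ : Fin n → ℤ) (a b : ℂ)
    (ε : ℂ) (α : Fin n → ℝ) : ℂ :=
  ∑ i, s i * ∑ᶠ k ∈ {k : ℕ | (I i).tropConst ρ - (k : ℂ) = a ∧ (I i).tropSlope ρ = b},
    (I i).taylorCoeff ρ k ε α

/-- The pairs `(a, b)` such that the power `t^{-(a + b ε)}` occurs in the Puiseux series along `ρ`
of the combination, after cancellations. -/
def tropExponents (s : ι → ℂ) (I : ι → EulerIntegrand n) (ρ : Fin n → ℤ) : Set (ℂ × ℂ) :=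
  {p | ∃ ε : ℂ, ∃ α : Fin n → ℝ, (∀ i, 0 < α i) ∧ puiseuxCoeff s I ρ p.1 p.2 ε α ≠ 0}

/-- `Trop (∑ i, s i • I i) (ρ)` for real `ε`: minus the exponent of the leading term of the Puiseux
series along `ρ` (its real part, if the exponents are complex); it is `-∞` if the series is zero. -/
def trop (s : ι → ℂ) (I : ι → EulerIntegrand n) (ρ : Fin n → ℤ) (ε : ℝ) : EReal :=
  ⨆ p ∈ tropExponents s I ρ, (((p.1 + (ε : ℂ) * p.2).re : ℝ) : EReal)

/-- `T(ε) = a + O(ε)` with `a < 0`, as `ε → 0`; this includes the tropicalization `-∞` of `0`. -/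
def NegLeading (T : ℝ → EReal) : Prop :=
  (∀ ε, T ε = ⊥) ∨
    ∃ a : ℝ, a < 0 ∧ ∃ r : ℝ → ℝ, r =O[𝓝 0] (fun ε : ℝ => ε) ∧
      ∀ᶠ ε in 𝓝 (0 : ℝ), T ε = ((a + r ε : ℝ) : EReal)

/-- The open positive orthant. -/
def orthant (n : ℕ) : Set (Fin n → ℝ) := {α | ∀ i, 0 < α i}

/-- The measure `dα/α = dα_1/α_1 ⋯ dα_n/α_n` on the positive orthant. -/
def logMeasure (n : ℕ) : Measure (Fin n → ℝ) :=
  (volume.restrict (orthant n)).withDensity fun α => ENNReal.ofReal (∏ i, (α i)⁻¹)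

/-- Integration against `dα/α` commutes with Taylor expansion at `ε = 0`: the integral converges
for `ε` near `0` and is analytic there, and its Taylor coefficients are the (convergent) integrals
of the Taylor coefficients of the integrand. -/
def LocallyFinite (f : ℂ → (Fin n → ℝ) → ℂ) : Prop :=
  (∀ᶠ ε in 𝓝 (0 : ℂ), Integrable (f ε) (logMeasure n)) ∧
  AnalyticAt ℂ (fun ε => ∫ α, f ε α ∂(logMeasure n)) 0 ∧
  ∀ k : ℕ,
    Integrable (fun α => iteratedDeriv k (fun ε => f ε α) 0) (logMeasure n) ∧
    iteratedDeriv k (fun ε => ∫ α, f ε α ∂(logMeasure n)) 0 =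
      ∫ α, iteratedDeriv k (fun ε => f ε α) 0 ∂(logMeasure n)

/-- The common refinement of the normal fans of the Newton polytopes of the `I i`. -/
def combFan (I : ι → EulerIntegrand n) : Set (PointedCone ℝ (Fin n → ℝ)) :=
  commonRefinement fun i => normalFan (I i).newt

end EulerInt

end

/-!
In logarithmic coordinates `α = exp x` the measure `dα/α` is Lebesgue measure, and local finiteness
follows from one estimate: the combination is bounded by `C exp (-δ ∑ |x_i|)`, uniformly for `ε`
near `0` (`exists_uniform_bound`). Given the estimate, the Cauchy inequalities dominate the
derivatives in `ε`, and Taylor expansion commutes with integration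
(`iteratedDeriv_integral_of_holomorphic`).

The estimate is proved cone by cone. Every `x` is a nonnegative combination of finitely many
integer vectors `ρ_r` on rays of the common refinement, all of them in one cone of it
(`exists_ray_generators`). On such a cone every `Trop P_j` is linear, so with `x = ∑ y_r ρ_r` and
`t_r = exp (-y_r)` each integrand is a monomial `∏ t_r^{-Trop I_i(ρ_r)}` times a function that is
smooth up to `t = 0` (`EulerIntegrand.eval_cone`). There is no need for the `ρ_r` to be linearly
independent or to form a lattice basis. They are chosen with even coordinates: the rescaled
polynomials then contain only even powers of the `t_r`, so they are positive for all real `t`, and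
the functions are smooth on the whole space.

Because of cancellations between the integrands the hypothesis does not bound them one by one. It
says that along a single ray `ρ_r`, with all other variables fixed, the combination decays
(`combEval_isBigO`): the collected coefficients of the other powers vanish. To combine the rays,
the smooth factors are Taylor expanded in `t_r` with smooth remainders
(`exists_taylor_expansion`), far enough for the remainders to come with positive powers of `t_r`.
The Taylor terms with non-decaying powers form a finite sum of exponentials in `y_r`, which tends
to zero since both the combination and the remainders do, and hence vanishes identically
(`expSum_eq_zero_of_tendsto`). What is left has the same shape as before, and its other exponents
are unchanged, so the rays can be treated one after another (`HasExpansion.insert`). In the end all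
powers of all the `t_r` are positive.
-/

noncomputable section

namespace EulerInt

open scoped ContDiff

/-! ### Hadamard quotients and sums of exponentials -/

section

theorem hasFDerivAt_parametric_integral {E F : Type} [NormedAddCommGroup E] [NormedSpace ℝ E]
    [ProperSpace E] [NormedAddCommGroup F] [NormedSpace ℝ F]
    (φ : E × ℝ → F) (hφ : ContDiff ℝ 1 φ) (e : E) :
    HasFDerivAt (fun e => ∫ u in (0 : ℝ)..1, φ (e, u))
      (∫ u in (0 : ℝ)..1, (fderiv ℝ φ (e, u)).comp (ContinuousLinearMap.inl ℝ E ℝ)) e := by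
  have hcont : Continuous fun p : E × ℝ =>
      (fderiv ℝ φ p).comp (ContinuousLinearMap.inl ℝ E ℝ) :=
    (hφ.continuous_fderiv one_ne_zero).clm_comp continuous_const
  obtain ⟨C, hC⟩ := ((isCompact_closedBall e 1).prod (isCompact_Icc (a := (0 : ℝ)) (b := 1))
    ).exists_bound_of_continuousOn hcont.continuousOn
  refine intervalIntegral.hasFDerivAt_integral_of_dominated_of_fderiv_le
    (F' := fun e u => (fderiv ℝ φ (e, u)).comp (ContinuousLinearMap.inl ℝ E ℝ))
    (bound := fun _ => C) (Metric.closedBall_mem_nhds e one_pos) ?_ ?_ ?_ ?_ ?_ ?_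
  · refine Eventually.of_forall fun x => Continuous.aestronglyMeasurable ?_
    exact hφ.continuous.comp (by fun_prop)
  · exact (hφ.continuous.comp (by fun_prop)).intervalIntegrable _ _
  · exact (hcont.comp (by fun_prop : Continuous fun u : ℝ => (e, u))).aestronglyMeasurable
  · refine Eventually.of_forall fun t ht x hx => hC (x, t) ⟨hx, ?_⟩
    rw [Set.uIoc_of_le zero_le_one] at ht
    exact ⟨ht.1.le, ht.2⟩
  · exact intervalIntegrable_const
  · refine Eventually.of_forall fun t _ x _ => ?_
    have h1 := (hφ.differentiable one_ne_zero (x, t)).hasFDerivAt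
    exact h1.comp x (hasFDerivAt_prodMk_left x t)

/-- An integral over `[0, 1]` depends smoothly on the parameters. The induction differentiates once
and so passes to integrands with values in a space of linear maps. -/
theorem contDiff_parametric_integral {E : Type} [NormedAddCommGroup E] [NormedSpace ℝ E]
    [ProperSpace E] {F : Type} [NormedAddCommGroup F] [NormedSpace ℝ F]
    (φ : E × ℝ → F) (hφ : ContDiff ℝ ∞ φ) :
    ContDiff ℝ ∞ (fun e => ∫ u in (0 : ℝ)..1, φ (e, u)) := by
  have key : ∀ n : ℕ, ∀ (F : Type) [NormedAddCommGroup F] [NormedSpace ℝ F] (φ : E × ℝ → F),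
      ContDiff ℝ ∞ φ → ContDiff ℝ n (fun e => ∫ u in (0 : ℝ)..1, φ (e, u)) := by
    intro n
    induction n with
    | zero =>
      intro F _ _ φ hφ
      rw [Nat.cast_zero, contDiff_zero]
      exact continuous_iff_continuousAt.2 fun e =>
        (hasFDerivAt_parametric_integral φ (hφ.of_le (by simp)) e).continuousAt
    | succ n ih =>
      intro F _ _ φ hφ
      have hd := fun e => hasFDerivAt_parametric_integral φ (hφ.of_le (by simp)) e
      rw [Nat.cast_succ, contDiff_succ_iff_fderiv]
      refine ⟨fun e => (hd e).differentiableAt, by simp, ?_⟩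
      rw [funext fun e => (hd e).fderiv]
      exact ih _ (fun p => (fderiv ℝ φ p).comp (ContinuousLinearMap.inl ℝ E ℝ))
        ((hφ.fderiv_right (m := ∞) (by simp)).clm_comp contDiff_const)
  exact contDiff_infty.2 fun n => key n F φ hφ

/-- Hadamard's lemma: the difference quotient in the coordinate `t_r` is smooth in all variables. -/
theorem exists_hadamard_quotient {R : Type} [Fintype R] [DecidableEq R] (r : R)
    (g : (R → ℝ) × ℂ → ℂ) (hg : ContDiff ℝ ∞ g) :
    ∃ h : (R → ℝ) × ℂ → ℂ, ContDiff ℝ ∞ h ∧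
      ∀ t ε, g (t, ε) = g (Function.update t r 0, ε) + (t r : ℂ) * h (t, ε) := by
  -- the affine path from `update t r 0` to `t`, with velocity `t r • e_r`
  set e : (R → ℝ) × ℂ := (Pi.single r 1, 0) with he
  set p : ((R → ℝ) × ℂ) × ℝ → (R → ℝ) × ℂ := fun q => q.1 + ((q.2 - 1) * q.1.1 r) • e with hp
  have hpc : ContDiff ℝ ∞ p := by
    rw [hp]; fun_prop
  have hD : ContDiff ℝ ∞ fun q => fderiv ℝ g (p q) e :=
    ((hg.fderiv_right (m := ∞) (by simp)).comp hpc).clm_apply contDiff_const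
  refine ⟨_, contDiff_parametric_integral _ hD, fun t ε => ?_⟩
  have hder : ∀ u : ℝ, HasDerivAt (fun u => g (p ((t, ε), u)))
      ((t r : ℂ) * fderiv ℝ g (p ((t, ε), u)) e) u := by
    intro u
    have h1 : HasDerivAt (fun u => p ((t, ε), u)) ((t r) • e) u := by
      have : HasDerivAt (fun u : ℝ => (u - 1) * t r) (t r) u := by
        simpa using ((hasDerivAt_id u).sub_const 1).mul_const (t r)
      simpa [hp] using (this.smul_const e).const_add (t, ε)
    have h2 := ((hg.differentiable (by simp)) (p ((t, ε), u))).hasFDerivAt.comp_hasDerivAt u h1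
    simpa [Function.comp_def] using h2
  have hcont : Continuous fun u : ℝ => (t r : ℂ) * fderiv ℝ g (p ((t, ε), u)) e :=
    continuous_const.mul (hD.continuous.comp (by fun_prop))
  have hint := intervalIntegral.integral_eq_sub_of_hasDerivAt (a := 0) (b := 1)
    (fun u _ => hder u) (hcont.intervalIntegrable _ _)
  rw [intervalIntegral.integral_const_mul] at hint
  have h0 : p ((t, ε), 0) = (Function.update t r 0, ε) := by
    simp only [hp, he]
    refine Prod.ext ?_ (by simp)
    funext i
    rcases eq_or_ne i r with rfl | hi
    · simp
    · simp [hi]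
  have h1 : p ((t, ε), 1) = (t, ε) := by simp [hp]
  rw [h0, h1] at hint
  rw [hint]; ring

/-- Taylor expansion in one coordinate, with coefficients and remainder smooth in all variables. -/
theorem exists_taylor_expansion {R : Type} [Fintype R] [DecidableEq R] (r : R)
    (g : (R → ℝ) × ℂ → ℂ) (hg : ContDiff ℝ ∞ g) (N : ℕ) :
    ∃ (c : ℕ → (R → ℝ) × ℂ → ℂ) (h : (R → ℝ) × ℂ → ℂ), ContDiff ℝ ∞ h ∧
      (∀ k t ε x, c k (Function.update t r x, ε) = c k (t, ε)) ∧
      ∀ t ε, g (t, ε) = ∑ k ∈ Finset.range N, (t r : ℂ) ^ k * c k (t, ε)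
        + (t r : ℂ) ^ N * h (t, ε) := by
  induction N with
  | zero => exact ⟨fun _ _ => 0, g, hg, by simp, by simp⟩
  | succ N ih =>
    obtain ⟨c, h, hh, hc, hs⟩ := ih
    obtain ⟨h', hh', hs'⟩ := exists_hadamard_quotient r h hh
    refine ⟨fun k => if k = N then fun q => h (Function.update q.1 r 0, q.2) else c k, h', hh',
      ?_, fun t ε => ?_⟩
    · intro k t ε x
      by_cases hk : k = N <;> simp [hk, hc]
    · rw [hs t ε, hs' t ε, Finset.sum_range_succ]
      have : ∀ k ∈ Finset.range N, (t r : ℂ) ^ k * (if k = N then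
          fun q : (R → ℝ) × ℂ => h (Function.update q.1 r 0, q.2) else c k) (t, ε) =
          (t r : ℂ) ^ k * c k (t, ε) := fun k hk => by rw [if_neg (Finset.mem_range.1 hk).ne]
      rw [Finset.sum_congr rfl this]
      simp only [if_true]
      ring

/-- A finite sum of exponentials none of which decays vanishes identically if it tends to zero. -/
theorem expSum_eq_zero_of_tendsto {κ : Type*} (s : Finset κ) (c z : κ → ℂ)
    (hz : ∀ k ∈ s, 0 ≤ (z k).re)
    (h : Tendsto (fun u : ℝ => ∑ k ∈ s, c k * Complex.exp (u * z k)) atTop (𝓝 0)) (u : ℝ) :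
    ∑ k ∈ s, c k * Complex.exp (u * z k) = 0 := by
  classical
  induction s using Finset.induction_on generalizing c u with
  | empty => simp
  | insert a s ha ih =>
    set f : ℝ → ℂ := fun u => ∑ k ∈ insert a s, c k * Complex.exp (u * z k) with hf
    -- the twisted difference removes the exponential with frequency `z a`
    have hdiff : ∀ v u : ℝ, f (u + v) - Complex.exp (v * z a) * f u =
        ∑ k ∈ s, (c k * (Complex.exp (v * z k) - Complex.exp (v * z a))) *
          Complex.exp (u * z k) := by
      intro v u
      simp only [hf, Finset.sum_insert ha, mul_add, Finset.mul_sum]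
      have : c a * Complex.exp (((u + v : ℝ) : ℂ) * z a) =
          Complex.exp (v * z a) * (c a * Complex.exp (u * z a)) := by
        push_cast; rw [add_mul, Complex.exp_add]; ring
      rw [this, add_sub_add_left_eq_sub, ← Finset.sum_sub_distrib]
      refine Finset.sum_congr rfl fun k _ => ?_
      push_cast; rw [add_mul, Complex.exp_add]; ring
    have hzero : ∀ v u : ℝ, f (u + v) = Complex.exp (v * z a) * f u := by
      intro v u
      rw [← sub_eq_zero, hdiff v u]
      refine ih _ (fun k hk => hz k (Finset.mem_insert_of_mem hk)) ?_ u
      simp_rw [← hdiff v]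
      simpa using (h.comp (tendsto_atTop_add_const_right _ v tendsto_id)).sub
        (h.const_mul (Complex.exp (v * z a)))
    have hf0 : ‖f u‖ ≤ 0 := by
      have hlim : Tendsto (fun v : ℝ => ‖f (u + v)‖) atTop (𝓝 0) := by
        simpa using (h.comp (tendsto_atTop_add_const_left _ u tendsto_id)).norm
      refine ge_of_tendsto hlim ?_
      filter_upwards [eventually_ge_atTop 0] with v hv
      rw [hzero, norm_mul, Complex.norm_exp]
      have : 1 ≤ Real.exp ((v * z a : ℂ).re) := by
        rw [Real.one_le_exp_iff]
        simpa using mul_nonneg hv (hz a (Finset.mem_insert_self _ _))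
      nlinarith [norm_nonneg (f u)]
    exact norm_le_zero_iff.1 hf0

end

/-! ### Functions with monomial expansions along several directions -/

section

theorem exists_pos_forall_le {κ : Type*} [Finite κ] (f : κ → ℝ) (hf : ∀ k, 0 < f k) :
    ∃ δ > 0, ∀ k, δ ≤ f k := by
  have h : ∀ᶠ δ in 𝓝[>] (0 : ℝ), ∀ k, δ ≤ f k :=
    eventually_all.2 fun k => (eventually_le_nhds (hf k)).filter_mono nhdsWithin_le_nhds
  obtain ⟨δ, h1, h2⟩ := (h.and self_mem_nhdsWithin).exists
  exact ⟨δ, h2, h1⟩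

/-- `(⌊x⌋ + 1).toNat` counts the natural numbers that are at most `x`. -/
theorem lt_toNat_floor_add_one_iff (x : ℝ) (k : ℕ) : k < (⌊x⌋ + 1).toNat ↔ (k : ℝ) ≤ x := by
  rw [← Int.cast_natCast, ← Int.le_floor]
  omega

/-- `expMonomial a b ε y = exp (∑ r, y_r (a_r + ε b_r))`: with `t_r = exp (-y_r)` this is the
monomial `∏ r, t_r^{-(a_r + ε b_r)}`. -/
def expMonomial {R : Type} [Fintype R] (a b : R → ℂ) (ε : ℂ) (y : R → ℝ) : ℂ :=
  Complex.exp (∑ r, (y r : ℂ) * (a r + ε * b r))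

theorem eventually_abs_re_mul_le {κ : Type*} [Finite κ] (b : κ → ℂ) {δ : ℝ} (hδ : 0 < δ) :
    ∀ᶠ ε in 𝓝 (0 : ℂ), ∀ k, |(ε * b k).re| ≤ δ := by
  refine eventually_all.2 fun k => ?_
  have : Tendsto (fun ε : ℂ => |(ε * b k).re|) (𝓝 0) (𝓝 |((0 : ℂ) * b k).re|) :=
    Continuous.tendsto (by fun_prop) _
  rw [zero_mul, Complex.zero_re, abs_zero] at this
  exact this.eventually (ge_mem_nhds hδ)

theorem expMonomial_update {R : Type} [Fintype R] [DecidableEq R] (a b : R → ℂ) (ε : ℂ)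
    (y : R → ℝ) (r : R) (u : ℝ) :
    expMonomial a b ε (Function.update y r u) =
      Complex.exp (∑ i ∈ Finset.univ.erase r, (y i : ℂ) * (a i + ε * b i)) *
        Complex.exp (u * (a r + ε * b r)) := by
  rw [expMonomial, ← Complex.exp_add, ← Finset.sum_erase_add _ _ (Finset.mem_univ r)]
  congr 2
  · refine Finset.sum_congr rfl fun i hi => ?_
    rw [Function.update_of_ne (Finset.ne_of_mem_erase hi)]
  · rw [Function.update_self]

theorem expMonomial_update_left {R : Type} [Fintype R] [DecidableEq R] (a b : R → ℂ) (ε : ℂ)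
    (y : R → ℝ) (r : R) (N : ℕ) :
    expMonomial a b ε y * ((Real.exp (-y r) : ℝ) : ℂ) ^ N =
      expMonomial (Function.update a r (a r - N)) b ε y := by
  rw [expMonomial, expMonomial, Complex.ofReal_exp, ← Complex.exp_nat_mul, ← Complex.exp_add,
    ← Finset.sum_erase_add _ _ (Finset.mem_univ r),
    ← Finset.sum_erase_add _ _ (Finset.mem_univ r), Function.update_self]
  have : ∀ i ∈ Finset.univ.erase r, (y i : ℂ) * (Function.update a r (a r - N) i + ε * b i) =
      (y i : ℂ) * (a i + ε * b i) := fun i hi => by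
    rw [Function.update_of_ne (Finset.ne_of_mem_erase hi)]
  rw [Finset.sum_congr rfl this]
  congr 1
  push_cast; ring

theorem exp_neg_update {R : Type} [DecidableEq R] (y : R → ℝ) (r : R) (u : ℝ) :
    (fun i => Real.exp (-(Function.update y r u i))) =
      Function.update (fun i => Real.exp (-y i)) r (Real.exp (-u)) := by
  funext i
  rcases eq_or_ne i r with rfl | hi <;> simp [*]

/-- `F` is, for small `ε`, a sum of monomials in `t = exp (-y)` times functions smooth in `(t, ε)`,
such that at `ε = 0` each monomial has a positive power of `t_r` for every `r ∈ S`. -/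
def HasExpansion {R : Type} [Fintype R] (Λ : Type*) [Fintype Λ] (S : Finset R)
    (F : (R → ℝ) → ℂ → ℂ) : Prop :=
  ∃ (a b : Λ → R → ℂ) (h : Λ → (R → ℝ) × ℂ → ℂ), (∀ l, ContDiff ℝ ∞ (h l)) ∧
    (∀ l, ∀ r ∈ S, (a l r).re < 0) ∧
    ∀ᶠ ε in 𝓝 (0 : ℂ), ∀ y, F y ε =
      ∑ l, expMonomial (a l) (b l) ε y * h l (fun r => Real.exp (-y r), ε)

/-- `F` decays exponentially in the direction `r`, for each fixed small `ε` and fixed values of the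
other variables. -/
def DecaysAlong {R : Type} [DecidableEq R] (F : (R → ℝ) → ℂ → ℂ) (r : R) : Prop :=
  ∃ δ > 0, ∀ᶠ ε in 𝓝 (0 : ℂ), ∀ y : R → ℝ,
    (fun u : ℝ => F (Function.update y r u) ε) =O[atTop] fun u => Real.exp (-(δ * u))

/-- The key step: decay in the direction `r` makes all non-decaying powers of `t_r` cancel, so that
they can be dropped from the expansion without affecting the other directions. -/
theorem HasExpansion.insert {R : Type} [Fintype R] [DecidableEq R] {Λ : Type*} [Fintype Λ]
    {S : Finset R} {F : (R → ℝ) → ℂ → ℂ} (hF : HasExpansion Λ S F) (r : R)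
    (hr : DecaysAlong F r) : HasExpansion Λ (insert r S) F := by
  obtain ⟨a, b, h, hh, ha, hF⟩ := hF
  obtain ⟨δ₀, hδ₀, hdec⟩ := hr
  -- the number of Taylor terms in `t_r` that leave a non-decaying power at `ε = 0`
  set N : Λ → ℕ := fun l => (⌊(a l r).re⌋ + 1).toNat with hN
  have hN1 : ∀ l, (a l r).re - N l < 0 := fun l => sub_neg.2
    (not_le.1 (mt (lt_toNat_floor_add_one_iff _ _).2 (lt_irrefl _)))
  have hN2 : ∀ l, ∀ k < N l, 0 ≤ (a l r).re - k := fun l k hk =>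
    sub_nonneg.2 ((lt_toNat_floor_add_one_iff _ _).1 hk)
  choose c h' hh' hc hsplit using fun l => exists_taylor_expansion r (h l) (hh l) (N l)
  set a' : Λ → R → ℂ := fun l => Function.update (a l) r (a l r - N l) with ha'
  have ha'r : ∀ l, (a' l r).re = (a l r).re - N l := fun l => by simp [ha']
  refine ⟨a', b, h', hh', ?_, ?_⟩
  · intro l i hi
    rcases eq_or_ne i r with rfl | hir
    · rw [ha'r]; exact hN1 l
    · simp only [ha', Function.update_of_ne hir]
      exact ha l i ((Finset.mem_insert.1 hi).resolve_left hir)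
  -- a decay rate beaten both by `F` and by the remainders, uniformly in small `ε`
  obtain ⟨δ, hδ, hδ1, hδ2⟩ : ∃ δ > 0, 2 * δ ≤ δ₀ ∧ ∀ l, 3 * δ ≤ -(a' l r).re := by
    obtain ⟨δ, hδ, h⟩ := exists_pos_forall_le (fun l => -(a' l r).re) fun l => by
      rw [ha'r]; linarith [hN1 l]
    refine ⟨min (δ₀ / 2) (δ / 3), lt_min (by linarith) (by linarith), ?_, fun l => ?_⟩
    · linarith [min_le_left (δ₀ / 2) (δ / 3)]
    · linarith [min_le_right (δ₀ / 2) (δ / 3), h l]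
  have hε := eventually_abs_re_mul_le (fun l => b l r) hδ
  filter_upwards [hF, hdec, hε] with ε hFε hdecε hε y
  -- the part of the expansion made of the non-decaying powers of `t_r`
  set K : Λ → ℂ := fun l =>
    Complex.exp (∑ i ∈ Finset.univ.erase r, (y i : ℂ) * (a l i + ε * b l i)) with hK
  set t : R → ℝ := fun i => Real.exp (-y i) with ht
  set s : Finset (Σ _ : Λ, ℕ) := Finset.univ.sigma fun l => Finset.range (N l) with hs
  set bad : ℝ → ℂ := fun u => ∑ p ∈ s, (K p.1 * c p.1 p.2 (t, ε)) *
    Complex.exp (u * (a p.1 r - p.2 + ε * b p.1 r)) with hbad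
  set good : ℝ → ℂ := fun u => ∑ l, expMonomial (a' l) (b l) ε (Function.update y r u) *
    h' l (Function.update t r (Real.exp (-u)), ε) with hgood
  have hsum : ∀ u, F (Function.update y r u) ε = bad u + good u := by
    intro u
    rw [hFε]
    simp only [hbad, hgood, hs]
    rw [Finset.sum_sigma, ← Finset.sum_add_distrib]
    refine Finset.sum_congr rfl fun l _ => ?_
    rw [exp_neg_update, hsplit l, mul_add, Finset.mul_sum]
    congr 1
    · refine Finset.sum_congr rfl fun k _ => ?_
      rw [hc, Function.update_self, expMonomial_update, Complex.ofReal_exp, ← Complex.exp_nat_mul]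
      have : Complex.exp (u * (a l r - k + ε * b l r)) =
          Complex.exp (u * (a l r + ε * b l r)) * Complex.exp (k * ((-u : ℝ) : ℂ)) := by
        rw [← Complex.exp_add]; congr 1; push_cast; ring
      simp only [this, hK]; ring
    · rw [← mul_assoc, Function.update_self]
      have := expMonomial_update_left (a l) (b l) ε (Function.update y r u) r (N l)
      rw [Function.update_self] at this
      rw [this]
  have hgoodO : good =O[atTop] fun u => Real.exp (-(2 * δ * u)) := by
    refine Asymptotics.IsBigO.fun_sum fun l _ => ?_
    have h1 : (fun u => expMonomial (a' l) (b l) ε (Function.update y r u)) =O[atTop]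
        fun u => Real.exp (-(2 * δ * u)) := by
      simp_rw [expMonomial_update]
      refine Asymptotics.IsBigO.const_mul_left ?_ _
      refine Asymptotics.IsBigO.of_bound 1 ?_
      filter_upwards [eventually_ge_atTop 0] with u hu
      rw [Complex.norm_exp, Real.norm_of_nonneg (Real.exp_pos _).le, one_mul]
      refine Real.exp_le_exp.2 ?_
      have h2 : ((u : ℂ) * (a' l r + ε * b l r)).re = u * ((a' l r).re + (ε * b l r).re) := by
        rw [Complex.re_ofReal_mul, Complex.add_re]
      rw [h2]
      have h3 := (abs_le.1 (hε l)).2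
      nlinarith [hδ2 l]
    have h2 : (fun u => h' l (Function.update t r (Real.exp (-u)), ε)) =O[atTop]
        fun _ => (1 : ℝ) := by
      refine Tendsto.isBigO_one (c := h' l (Function.update t r 0, ε)) ℝ ?_
      have h3 : Continuous fun v : ℝ => h' l (Function.update t r v, ε) :=
        (hh' l).continuous.comp (Continuous.prodMk
          ((continuous_const (y := t)).update r continuous_id) continuous_const)
      exact (h3.tendsto 0).comp (Real.tendsto_exp_neg_atTop_nhds_zero)
    simpa using h1.mul h2
  have hbadO : bad =O[atTop] fun u => Real.exp (-(2 * δ * u)) := by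
    have h1 : (fun u => F (Function.update y r u) ε) =O[atTop]
        fun u => Real.exp (-(2 * δ * u)) := by
      refine (hdecε y).trans (Asymptotics.IsBigO.of_bound 1 ?_)
      filter_upwards [eventually_ge_atTop 0] with u hu
      rw [Real.norm_of_nonneg (Real.exp_pos _).le, Real.norm_of_nonneg (Real.exp_pos _).le,
        one_mul]
      exact Real.exp_le_exp.2 (by nlinarith)
    refine (h1.sub hgoodO).congr_left fun u => ?_
    rw [hsum u]; ring
  have hbad0 : bad (y r) = 0 := by
    have hsh : ∀ u : ℝ, ∑ p ∈ s, (K p.1 * c p.1 p.2 (t, ε)) *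
        Complex.exp (u * (a p.1 r - p.2 + ε * b p.1 r + δ)) =
        bad u * Complex.exp (u * δ) := by
      intro u
      rw [hbad, Finset.sum_mul]
      refine Finset.sum_congr rfl fun p _ => ?_
      rw [mul_assoc _ (Complex.exp _), ← Complex.exp_add]
      congr 2; ring
    have h0 := expSum_eq_zero_of_tendsto s (fun p => K p.1 * c p.1 p.2 (t, ε))
      (fun p => a p.1 r - p.2 + ε * b p.1 r + δ) (fun p hp => ?_) ?_ (y r)
    · rw [hsh] at h0
      exact (mul_eq_zero.1 h0).resolve_right (Complex.exp_ne_zero _)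
    · have h1 := hN2 p.1 p.2 (Finset.mem_range.1 (Finset.mem_sigma.1 hp).2)
      have h2 := (abs_le.1 (hε p.1)).1
      simp only [Complex.add_re, Complex.sub_re, Complex.natCast_re, Complex.ofReal_re]
      linarith
    · simp_rw [hsh]
      have h1 : (fun u : ℝ => bad u * Complex.exp (u * δ)) =O[atTop]
          fun u => Real.exp (-(δ * u)) := by
        have h2 : (fun u : ℝ => Complex.exp (u * δ)) =O[atTop] fun u => Real.exp (δ * u) := by
          refine Asymptotics.IsBigO.of_bound 1 (Eventually.of_forall fun u => ?_)
          rw [Complex.norm_exp, Real.norm_of_nonneg (Real.exp_pos _).le, one_mul]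
          simp [mul_comm]
        refine (hbadO.mul h2).congr_right fun u => ?_
        rw [← Real.exp_add]; congr 1; ring
      refine h1.trans_tendsto ?_
      exact Real.tendsto_exp_neg_atTop_nhds_zero.comp (tendsto_id.const_mul_atTop hδ)
  have hfin := hsum (y r)
  rw [hbad0, zero_add, hgood] at hfin
  simpa only [Function.update_eq_self, ht] using hfin

/-- Decay in each direction separately implies joint decay, given an expansion. -/
theorem HasExpansion.exists_bound {R : Type} [Fintype R] [DecidableEq R] {Λ : Type*} [Fintype Λ]
    {F : (R → ℝ) → ℂ → ℂ} (hF : HasExpansion Λ ∅ F) (hr : ∀ r, DecaysAlong F r) :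
    ∃ δ > 0, ∃ C, ∀ᶠ ε in 𝓝 (0 : ℂ), ∀ y : R → ℝ, (∀ r, 0 ≤ y r) →
      ‖F y ε‖ ≤ C * Real.exp (-(δ * ∑ r, y r)) := by
  have hall : ∀ S : Finset R, HasExpansion Λ S F := by
    intro S
    induction S using Finset.induction_on with
    | empty => exact hF
    | insert r S _ ih => exact ih.insert r (hr r)
  obtain ⟨a, b, h, hh, ha, hF⟩ := hall Finset.univ
  obtain ⟨δ, hδ, hδ2⟩ : ∃ δ > 0, ∀ l r, 2 * δ ≤ -(a l r).re := by
    obtain ⟨δ, hδ, h⟩ := exists_pos_forall_le (fun p : Λ × R => -(a p.1 p.2).re) fun p => by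
      linarith [ha p.1 p.2 (Finset.mem_univ p.2)]
    exact ⟨δ / 2, by linarith, fun l r => by linarith [h (l, r)]⟩
  have hε := eventually_abs_re_mul_le (fun p : Λ × R => b p.1 p.2) hδ
  have hcpt : IsCompact ((Set.univ.pi fun _ : R => Set.Icc (0 : ℝ) 1) ×ˢ
      Metric.closedBall (0 : ℂ) 1) :=
    (isCompact_univ_pi fun _ => isCompact_Icc).prod (isCompact_closedBall _ _)
  choose C hC using fun l => hcpt.exists_bound_of_continuousOn (hh l).continuous.continuousOn
  refine ⟨δ, hδ, ∑ l, C l, ?_⟩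
  filter_upwards [hF, hε, Metric.closedBall_mem_nhds (0 : ℂ) one_pos] with ε hFε hε hball y hy
  rw [hFε, Finset.sum_mul]
  refine (norm_sum_le _ _).trans (Finset.sum_le_sum fun l _ => ?_)
  rw [norm_mul, mul_comm]
  refine mul_le_mul (hC l _ ⟨fun r _ => ⟨(Real.exp_pos _).le, ?_⟩, hball⟩) ?_ (norm_nonneg _) ?_
  · exact Real.exp_le_one_iff.2 (by linarith [hy r])
  · rw [expMonomial, Complex.norm_exp]
    refine Real.exp_le_exp.2 ?_
    rw [Complex.re_sum, Finset.mul_sum, ← Finset.sum_neg_distrib]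
    refine Finset.sum_le_sum fun r _ => ?_
    rw [Complex.re_ofReal_mul, Complex.add_re]
    nlinarith [hy r, (abs_le.1 (hε (l, r))).2, hδ2 l r]
  · exact (norm_nonneg _).trans (hC l (fun _ => 0, 0)
      ⟨fun r _ => ⟨le_rfl, zero_le_one⟩, Metric.mem_closedBall_self zero_le_one⟩)

end

/-! ### Euler integrands on a cone -/

section

/-- The point of the positive orthant with logarithmic coordinates `x`. -/
def expVec {n : ℕ} (x : Fin n → ℝ) : Fin n → ℝ := fun i => Real.exp (x i)

/-- The real vector with the integer coordinates `ρ`. -/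
def realVec {n : ℕ} (ρ : Fin n → ℤ) : Fin n → ℝ := fun i => (ρ i : ℝ)

theorem expVec_pos {n : ℕ} (x : Fin n → ℝ) (i : Fin n) : 0 < expVec x i := Real.exp_pos _

theorem prod_expVec_zpow {n : ℕ} (x : Fin n → ℝ) (m : Fin n → ℤ) :
    ∏ i, expVec x i ^ m i = Real.exp (x ⬝ᵥ realVec m) := by
  simp only [expVec, dotProduct, realVec]
  rw [Real.exp_sum]
  refine Finset.prod_congr rfl fun i _ => ?_
  rw [mul_comm, ← Real.rpow_intCast, ← Real.exp_mul, mul_comm]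

theorem realVec_dotProduct {n : ℕ} (ρ m : Fin n → ℤ) :
    realVec ρ ⬝ᵥ realVec m = ((ρ ⬝ᵥ m : ℤ) : ℝ) := by
  simp [dotProduct, realVec]

namespace EulerIntegrand

variable {n : ℕ}

theorem monomial_expVec (I : EulerIntegrand n) (ε : ℂ) (x : Fin n → ℝ) :
    I.monomial ε (expVec x) = Complex.exp (∑ i, (x i : ℂ) * (I.ν₀ i + ε * I.ν₁ i)) := by
  rw [monomial, Complex.exp_sum]
  refine Finset.prod_congr rfl fun i _ => ?_
  rw [Complex.cpow_def_of_ne_zero (by exact_mod_cast (expVec_pos x i).ne'), expVec,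
    ← Complex.ofReal_log (Real.exp_pos _).le, Real.log_exp]

theorem support_nonempty (I : EulerIntegrand n) (j : Fin I.m) :
    (I.P j).coeff.support.Nonempty :=
  Finsupp.support_nonempty_iff.2 fun h => I.P_ne_zero j (by ext k; simp [h])

theorem coeff_pos (I : EulerIntegrand n) {j : Fin I.m} {k : Fin n → ℤ}
    (hk : k ∈ (I.P j).coeff.support) : 0 < (I.P j).coeff k :=
  lt_of_le_of_ne (I.P_nonneg j k) (Finsupp.mem_support_iff.1 hk).symm

theorem le_tropPoly (I : EulerIntegrand n) (ρ : Fin n → ℤ) {j : Fin I.m} {k : Fin n → ℤ}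
    (hk : k ∈ (I.P j).coeff.support) : ρ ⬝ᵥ k ≤ I.tropPoly ρ j :=
  Finset.le_sup' (fun m => ρ ⬝ᵥ m) hk

theorem exists_tropPoly_eq (I : EulerIntegrand n) (ρ : Fin n → ℤ) (j : Fin I.m) :
    ∃ k ∈ (I.P j).coeff.support, I.tropPoly ρ j = ρ ⬝ᵥ k :=
  Finset.exists_mem_eq_sup' _ _

/-- The multivariate version of `rescaledPoly`: the polynomial in `t` that is equal, for positive
`t`, to `∏ r, t_r^{Trop P_j (ρ_r)} P_j(α ∏ r, t_r^{-ρ_r})`. -/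
def rescaledPolys {R : Type} [Fintype R] (I : EulerIntegrand n) (ρ : R → Fin n → ℤ) (j : Fin I.m)
    (α : Fin n → ℝ) (t : R → ℝ) : ℝ :=
  (I.P j).coeff.sum fun m s =>
    s * (∏ i, α i ^ m i) * ∏ r, t r ^ (I.tropPoly (ρ r) j - ρ r ⬝ᵥ m).toNat

/-- The multivariate version of `rescaled`. -/
def rescaledBy {R : Type} [Fintype R] (I : EulerIntegrand n) (ρ : R → Fin n → ℤ) (ε : ℂ)
    (α : Fin n → ℝ) (t : R → ℝ) : ℂ :=
  I.monomial ε α * ∏ j, ((I.rescaledPolys ρ j α t : ℝ) : ℂ) ^ (I.c₀ j + ε * I.c₁ j)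

theorem rescaledPolys_unit (I : EulerIntegrand n) (ρ : Fin n → ℤ) (j : Fin I.m)
    (α : Fin n → ℝ) (t : ℝ) :
    I.rescaledPolys (fun _ : Unit => ρ) j α (fun _ => t) = I.rescaledPoly ρ j α t := by
  simp [rescaledPolys, rescaledPoly]

theorem rescaledBy_unit (I : EulerIntegrand n) (ρ : Fin n → ℤ) (ε : ℂ) (α : Fin n → ℝ) (t : ℝ) :
    I.rescaledBy (fun _ : Unit => ρ) ε α (fun _ => t) = I.rescaled ρ ε α t := by
  simp only [rescaledBy, rescaled, rescaledPolys_unit]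

/-- The `ρ_r` have a common maximizer on the exponents of each `P_j`; equivalently, `Trop P_j` is
linear on the cone that they span. -/
def IsCommonCone {R : Type} (I : EulerIntegrand n) (ρ : R → Fin n → ℤ) : Prop :=
  ∀ j, ∃ k ∈ (I.P j).coeff.support, ∀ r, I.tropPoly (ρ r) j = ρ r ⬝ᵥ k

variable {R : Type} [Fintype R]

/-- If the vectors `ρ_r` are even, then the rescaled polynomials involve only even powers, hence
are positive at all real `t`, not only on the unit cube. -/
theorem rescaledPolys_pos (I : EulerIntegrand n) (ρ : R → Fin n → ℤ)
    (hρ : ∀ r i, Even (ρ r i)) (hI : I.IsCommonCone ρ) (j : Fin I.m) {α : Fin n → ℝ}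
    (hα : ∀ i, 0 < α i) (t : R → ℝ) : 0 < I.rescaledPolys ρ j α t := by
  obtain ⟨k, hk, hmax⟩ := hI j
  have hdot : ∀ r (m : Fin n → ℤ), Even (ρ r ⬝ᵥ m) := fun r m =>
    Finset.even_sum _ fun i _ => (hρ r i).mul_right _
  refine Finset.sum_pos' (fun m _ => ?_) ⟨k, hk, ?_⟩
  · refine mul_nonneg (mul_nonneg (I.P_nonneg j m)
      (Finset.prod_nonneg fun i _ => (zpow_pos (hα i) _).le))
      (Finset.prod_nonneg fun r _ => Even.pow_nonneg ?_ _)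
    have h1 : Even (I.tropPoly (ρ r) j - ρ r ⬝ᵥ m) := by
      rw [hmax r]; exact (hdot r k).sub (hdot r m)
    rcases le_total 0 (I.tropPoly (ρ r) j - ρ r ⬝ᵥ m) with h | h
    · rw [← Int.even_coe_nat, Int.toNat_of_nonneg h]; exact h1
    · rw [Int.toNat_of_nonpos h]; exact Even.zero
  · have : ∏ r, t r ^ (I.tropPoly (ρ r) j - ρ r ⬝ᵥ k).toNat = 1 :=
      Finset.prod_eq_one fun r _ => by rw [hmax r]; simp
    simp only [this, mul_one]
    exact mul_pos (I.coeff_pos hk) (Finset.prod_pos fun i _ => zpow_pos (hα i) _)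

theorem contDiff_rescaledPolys (I : EulerIntegrand n) (ρ : R → Fin n → ℤ) (j : Fin I.m)
    (α : Fin n → ℝ) : ContDiff ℝ ∞ (I.rescaledPolys ρ j α) := by
  refine ContDiff.sum fun m _ => contDiff_const.mul (contDiff_prod fun r _ => ?_)
  exact (contDiff_apply ℝ ℝ r).pow _

theorem contDiff_rescaledBy (I : EulerIntegrand n) (ρ : R → Fin n → ℤ)
    (hρ : ∀ r i, Even (ρ r i)) (hI : I.IsCommonCone ρ) (x : Fin n → ℝ) :
    ContDiff ℝ ∞ fun q : (R → ℝ) × ℂ => I.rescaledBy ρ q.2 (expVec x) q.1 := by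
  have hpos := fun j t => I.rescaledPolys_pos ρ hρ hI j (expVec_pos x) t
  have h : (fun q : (R → ℝ) × ℂ => I.rescaledBy ρ q.2 (expVec x) q.1) = fun q =>
      Complex.exp (∑ i, (x i : ℂ) * (I.ν₀ i + q.2 * I.ν₁ i)) *
      ∏ j, Complex.exp (((Real.log (I.rescaledPolys ρ j (expVec x) q.1) : ℝ) : ℂ) *
        (I.c₀ j + q.2 * I.c₁ j)) := by
    funext q
    rw [rescaledBy, monomial_expVec]
    congr 1
    refine Finset.prod_congr rfl fun j _ => ?_
    rw [Complex.cpow_def_of_ne_zero (by exact_mod_cast (hpos j q.1).ne'),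
      ← Complex.ofReal_log (hpos j q.1).le]
  rw [h]
  refine ContDiff.mul (ContDiff.cexp (ContDiff.sum fun i _ => ?_))
    (contDiff_prod fun j _ => ContDiff.cexp (ContDiff.mul ?_ ?_))
  · fun_prop
  · exact Complex.ofRealCLM.contDiff.comp
      ((((I.contDiff_rescaledPolys ρ j (expVec x)).comp contDiff_fst).log
        fun q => (hpos j q.1).ne'))
  · fun_prop

/-- In the variables `t = exp (-y)` the polynomial `P_j` is its leading monomial times a polynomial. -/
theorem eval_poly_cone (I : EulerIntegrand n) (ρ : R → Fin n → ℤ) (j : Fin I.m)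
    (x : Fin n → ℝ) (y : R → ℝ) :
    (I.P j).eval (expVec (x + ∑ r, y r • realVec (ρ r))) =
      Real.exp (∑ r, y r * I.tropPoly (ρ r) j) *
        I.rescaledPolys ρ j (expVec x) fun r => Real.exp (-y r) := by
  rw [Laurent.eval, rescaledPolys, Finsupp.sum, Finsupp.sum, Finset.mul_sum]
  refine Finset.sum_congr rfl fun m hm => ?_
  have h1 : ∏ r, Real.exp (-y r) ^ (I.tropPoly (ρ r) j - ρ r ⬝ᵥ m).toNat =
      Real.exp (∑ r, -(y r * (I.tropPoly (ρ r) j - (ρ r ⬝ᵥ m : ℤ)))) := by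
    rw [Real.exp_sum]
    refine Finset.prod_congr rfl fun r _ => ?_
    rw [← Real.exp_nat_mul, ← Int.cast_natCast,
      Int.toNat_of_nonneg (sub_nonneg.2 (I.le_tropPoly (ρ r) hm))]
    congr 1; push_cast; ring
  have h2 : (x + ∑ r, y r • realVec (ρ r)) ⬝ᵥ realVec m =
      x ⬝ᵥ realVec m + ∑ r, y r * ((ρ r ⬝ᵥ m : ℤ) : ℝ) := by
    rw [add_dotProduct, sum_dotProduct]
    simp only [smul_dotProduct, realVec_dotProduct, smul_eq_mul]
  rw [h1, prod_expVec_zpow, prod_expVec_zpow, h2]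
  have h3 : ∑ r, -(y r * ((I.tropPoly (ρ r) j : ℝ) - (ρ r ⬝ᵥ m : ℤ))) =
      ∑ r, y r * ((ρ r ⬝ᵥ m : ℤ) : ℝ) - ∑ r, y r * I.tropPoly (ρ r) j := by
    rw [← Finset.sum_sub_distrib]
    exact Finset.sum_congr rfl fun r _ => by ring
  rw [h3, Real.exp_add, Real.exp_sub]
  field_simp

/-- On a cone where every `Trop P_j` is linear, the integrand is a monomial in `t = exp (-y)` times
a function that is smooth up to `t = 0`. -/
theorem eval_cone (I : EulerIntegrand n) (ρ : R → Fin n → ℤ)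
    (hρ : ∀ r i, Even (ρ r i)) (hI : I.IsCommonCone ρ) (ε : ℂ) (x : Fin n → ℝ) (y : R → ℝ) :
    I.eval ε (expVec (x + ∑ r, y r • realVec (ρ r))) =
      expMonomial (fun r => I.tropConst (ρ r)) (fun r => I.tropSlope (ρ r)) ε y *
        I.rescaledBy ρ ε (expVec x) fun r => Real.exp (-y r) := by
  have hpos := fun j => I.rescaledPolys_pos ρ hρ hI j (expVec_pos x) fun r => Real.exp (-y r)
  have h1 : ∀ j, (((I.P j).eval (expVec (x + ∑ r, y r • realVec (ρ r))) : ℝ) : ℂ) ^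
      (I.c₀ j + ε * I.c₁ j) =
      Complex.exp ((∑ r, (y r : ℂ) * I.tropPoly (ρ r) j) * (I.c₀ j + ε * I.c₁ j)) *
      ((I.rescaledPolys ρ j (expVec x) (fun r => Real.exp (-y r)) : ℝ) : ℂ) ^
        (I.c₀ j + ε * I.c₁ j) := by
    intro j
    rw [eval_poly_cone, Complex.ofReal_mul,
      Complex.mul_cpow_ofReal_nonneg (Real.exp_pos _).le (hpos j).le]
    congr 1
    rw [Complex.cpow_def_of_ne_zero (by exact_mod_cast (Real.exp_pos _).ne'),
      ← Complex.ofReal_log (Real.exp_pos _).le, Real.log_exp]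
    push_cast; rfl
  rw [eval, rescaledBy, Finset.prod_congr rfl fun j _ => h1 j, Finset.prod_mul_distrib,
    monomial_expVec, monomial_expVec, expMonomial, ← Complex.exp_sum]
  have h2 : ∑ i, ((x + ∑ r, y r • realVec (ρ r)) i : ℂ) * (I.ν₀ i + ε * I.ν₁ i) +
      ∑ j, (∑ r, (y r : ℂ) * I.tropPoly (ρ r) j) * (I.c₀ j + ε * I.c₁ j) =
      ∑ r, (y r : ℂ) * (I.tropConst (ρ r) + ε * I.tropSlope (ρ r)) +
        ∑ i, (x i : ℂ) * (I.ν₀ i + ε * I.ν₁ i) := by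
    have h3 : ∀ r, (y r : ℂ) * (I.tropConst (ρ r) + ε * I.tropSlope (ρ r)) =
        ∑ i, (y r : ℂ) * (ρ r i : ℂ) * (I.ν₀ i + ε * I.ν₁ i) +
        ∑ j, (y r : ℂ) * I.tropPoly (ρ r) j * (I.c₀ j + ε * I.c₁ j) := by
      intro r
      rw [tropConst, tropSlope, mul_add, mul_add, mul_add, mul_add, add_add_add_comm]
      simp only [Finset.mul_sum, ← Finset.sum_add_distrib]
      congr 1 <;> exact Finset.sum_congr rfl fun _ _ => by ring
    rw [Finset.sum_congr rfl fun r _ => h3 r, Finset.sum_add_distrib, Finset.sum_comm,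
      Finset.sum_comm (s := Finset.univ (α := R)) (f := fun r j => (y r : ℂ) * _ * _)]
    simp only [Finset.sum_mul, Pi.add_apply, Finset.sum_apply, Pi.smul_apply, smul_eq_mul, realVec]
    push_cast
    simp only [add_mul, Finset.sum_mul, Finset.sum_add_distrib]
    ring
  rw [← mul_assoc, ← Complex.exp_add, h2, Complex.exp_add]
  ring

end EulerIntegrand

variable {n : ℕ} {ι : Type*} [Fintype ι]

theorem hasExpansion_combEval {R : Type} [Fintype R] (s : ι → ℂ) (I : ι → EulerIntegrand n)
    (ρ : R → Fin n → ℤ) (hρ : ∀ r i, Even (ρ r i)) (hI : ∀ i, (I i).IsCommonCone ρ) :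
    HasExpansion ι ∅ fun (y : R → ℝ) ε => combEval s I ε (expVec (∑ r, y r • realVec (ρ r))) := by
  refine ⟨fun i r => (I i).tropConst (ρ r), fun i r => (I i).tropSlope (ρ r),
    fun i q => s i * (I i).rescaledBy ρ q.2 (expVec 0) q.1, fun i =>
      contDiff_const.mul ((I i).contDiff_rescaledBy ρ hρ (hI i) 0), by simp,
    Eventually.of_forall fun ε y => Finset.sum_congr rfl fun i _ => ?_⟩
  have := (I i).eval_cone ρ hρ (hI i) ε 0 y
  rw [zero_add] at this
  rw [this]; ring

end

/-! ### Decay along a ray and on a cone -/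

section

variable {n : ℕ} {ι : Type*} [Fintype ι]

theorem EulerIntegrand.isCommonCone_unit (I : EulerIntegrand n) (ρ : Fin n → ℤ) :
    I.IsCommonCone (fun _ : Unit => ρ) := fun j => by
  obtain ⟨k, hk, h⟩ := I.exists_tropPoly_eq ρ j
  exact ⟨k, hk, fun _ => h⟩

theorem EulerIntegrand.contDiff_rescaled (I : EulerIntegrand n) (ρ : Fin n → ℤ)
    (hρ : ∀ i, Even (ρ i)) (ε : ℂ) (x : Fin n → ℝ) :
    ContDiff ℝ ∞ (I.rescaled ρ ε (expVec x)) := by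
  have h1 := I.contDiff_rescaledBy (fun _ : Unit => ρ) (fun _ => hρ) (I.isCommonCone_unit ρ) x
  have h2 : ContDiff ℝ ∞ fun t : ℝ => (((fun _ => t), ε) : (Unit → ℝ) × ℂ) :=
    (contDiff_pi.2 fun _ => contDiff_id).prodMk contDiff_const
  have h3 := h1.comp h2
  simp only [Function.comp_def, rescaledBy_unit] at h3
  exact h3

/-- At a pair `p` with `0 ≤ re p.1`, only finitely many Taylor coefficients enter the collected
coefficient. -/
theorem puiseuxCoeff_eq_sum (s : ι → ℂ) (I : ι → EulerIntegrand n) (ρ : Fin n → ℤ) (p : ℂ × ℂ)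
    (hp : 0 ≤ p.1.re) (ε : ℂ) (α : Fin n → ℝ) :
    puiseuxCoeff s I ρ p.1 p.2 ε α =
      ∑ i, ∑ k ∈ (Finset.range (⌊((I i).tropConst ρ).re⌋ + 1).toNat).filter
        (fun k : ℕ => ((I i).tropConst ρ - (k : ℂ), (I i).tropSlope ρ) = p),
        s i * (I i).taylorCoeff ρ k ε α := by
  refine Finset.sum_congr rfl fun i _ => ?_
  rw [← Finset.mul_sum, ← finsum_mem_coe_finset]
  congr 2
  funext k
  have : (k ∈ {k : ℕ | (I i).tropConst ρ - (k : ℂ) = p.1 ∧ (I i).tropSlope ρ = p.2}) ↔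
      k ∈ ((Finset.range (⌊((I i).tropConst ρ).re⌋ + 1).toNat).filter
        (fun k : ℕ => ((I i).tropConst ρ - (k : ℂ), (I i).tropSlope ρ) = p) : Set ℕ) := by
    simp only [Set.mem_ofPred_eq, Finset.coe_filter, Finset.mem_range, lt_toNat_floor_add_one_iff,
      Prod.ext_iff]
    refine ⟨fun h => ⟨?_, h⟩, fun h => h.2⟩
    have h1 := hp
    rw [← h.1, Complex.sub_re, Complex.natCast_re] at h1
    linarith
  simp only [this]

/-- If all the powers in the Puiseux series along `ρ` decay at `ε = 0`, then so does the
combination. -/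
theorem combEval_isBigO (s : ι → ℂ) (I : ι → EulerIntegrand n) (ρ : Fin n → ℤ)
    (hρ : ∀ i, Even (ρ i)) (hneg : ∀ p ∈ tropExponents s I ρ, p.1.re < 0) :
    ∃ δ > 0, ∀ᶠ ε in 𝓝 (0 : ℂ), ∀ x : Fin n → ℝ,
      (fun u : ℝ => combEval s I ε (expVec (x + u • realVec ρ))) =O[atTop]
        fun u => Real.exp (-(δ * u)) := by
  set N : ι → ℕ := fun i => (⌊((I i).tropConst ρ).re⌋ + 1).toNat with hN
  have hN1 : ∀ i, ((I i).tropConst ρ).re - N i < 0 := fun l => sub_neg.2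
    (not_le.1 (mt (lt_toNat_floor_add_one_iff _ _).2 (lt_irrefl _)))
  obtain ⟨δ, hδ, hδN⟩ := exists_pos_forall_le (fun i => -(((I i).tropConst ρ).re - N i))
    fun i => by linarith [hN1 i]
  refine ⟨δ / 2, by positivity, ?_⟩
  filter_upwards [eventually_abs_re_mul_le (fun i => (I i).tropSlope ρ) (half_pos hδ)] with ε hε x
  have heval : ∀ i (u : ℝ), (I i).eval ε (expVec (x + u • realVec ρ)) =
      Complex.exp (u * ((I i).tropConst ρ + ε * (I i).tropSlope ρ)) *
        (I i).rescaled ρ ε (expVec x) (Real.exp (-u)) := by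
    intro i u
    have := (I i).eval_cone (fun _ : Unit => ρ) (fun _ => hρ) ((I i).isCommonCone_unit ρ) ε x (fun _ => u)
    simpa [expMonomial, EulerIntegrand.rescaledBy_unit] using this
  have hsmooth := fun i => (I i).contDiff_rescaled ρ hρ ε x
  set rem : ι → ℝ → ℂ := fun i t => (I i).rescaled ρ ε (expVec x) t -
    ∑ k ∈ Finset.range (N i), (t : ℂ) ^ k * (I i).taylorCoeff ρ k ε (expVec x) with hrem
  have hremO : ∀ i, rem i =O[𝓝 0] fun t => t ^ N i := by
    intro i
    have h1 := (taylor_isLittleO_univ (x₀ := 0) (n := N i)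
      ((hsmooth i).of_le (by exact_mod_cast le_top))).isBigO
    have h2 : (fun t : ℝ => (t : ℂ) ^ N i * (I i).taylorCoeff ρ (N i) ε (expVec x))
        =O[𝓝 0] fun t => t ^ N i := by
      refine Asymptotics.IsBigO.of_bound ‖(I i).taylorCoeff ρ (N i) ε (expVec x)‖
        (Eventually.of_forall fun t => ?_)
      rw [norm_mul, norm_pow, norm_pow, Complex.norm_real, mul_comm]
    refine ((h1.congr_right fun t => by rw [sub_zero]).add h2).congr_left fun t => ?_
    rw [taylor_within_apply, Finset.sum_range_succ]
    simp only [hrem, iteratedDerivWithin_univ, sub_zero, EulerIntegrand.taylorCoeff]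
    have h3 : ∀ k, ((k.factorial : ℝ)⁻¹ * t ^ k) • iteratedDeriv k
        ((I i).rescaled ρ ε (expVec x)) 0 =
        (t : ℂ) ^ k * (iteratedDeriv k ((I i).rescaled ρ ε (expVec x)) 0 / (k.factorial : ℂ)) := by
      intro k
      rw [Complex.real_smul]; push_cast; ring
    simp only [h3]
    ring
  -- the non-decaying powers cancel, because their collected coefficients vanish
  have hbad : ∀ u : ℝ, ∑ i, ∑ k ∈ Finset.range (N i),
      s i * (I i).taylorCoeff ρ k ε (expVec x) *
        Complex.exp (u * ((I i).tropConst ρ - k + ε * (I i).tropSlope ρ)) = 0 := by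
    intro u
    set f : (Σ _ : ι, ℕ) → ℂ × ℂ := fun q =>
      ((I q.1).tropConst ρ - (q.2 : ℂ), (I q.1).tropSlope ρ) with hf
    set S : Finset (Σ _ : ι, ℕ) := Finset.univ.sigma fun i => Finset.range (N i) with hS
    rw [← Finset.sum_sigma (s := Finset.univ) (t := fun i => Finset.range (N i))
      (f := fun q => s q.1 * (I q.1).taylorCoeff ρ q.2 ε (expVec x) *
        Complex.exp (u * ((I q.1).tropConst ρ - q.2 + ε * (I q.1).tropSlope ρ))),
      ← Finset.sum_fiberwise_of_maps_to (t := S.image f) (g := f)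
        fun q hq => Finset.mem_image_of_mem f hq]
    refine Finset.sum_eq_zero fun p hp => ?_
    have hp0 : 0 ≤ p.1.re := by
      obtain ⟨q, hq, rfl⟩ := Finset.mem_image.1 hp
      have := (lt_toNat_floor_add_one_iff _ _).1 (Finset.mem_range.1 (Finset.mem_sigma.1 hq).2)
      simpa [hf] using this
    have hcoeff : puiseuxCoeff s I ρ p.1 p.2 ε (expVec x) = 0 := by
      by_contra h
      exact absurd (hneg p ⟨ε, expVec x, expVec_pos x, h⟩) (not_lt.2 hp0)
    rw [puiseuxCoeff_eq_sum s I ρ p hp0] at hcoeff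
    have h1 : ∀ q ∈ S.filter (fun q => f q = p),
        s q.1 * (I q.1).taylorCoeff ρ q.2 ε (expVec x) *
          Complex.exp (u * ((I q.1).tropConst ρ - q.2 + ε * (I q.1).tropSlope ρ)) =
        s q.1 * (I q.1).taylorCoeff ρ q.2 ε (expVec x) * Complex.exp (u * (p.1 + ε * p.2)) := by
      intro q hq
      rw [← (Finset.mem_filter.1 hq).2]
    rw [Finset.sum_congr rfl h1, ← Finset.sum_mul]
    have h2 : S.filter (fun q => f q = p) = Finset.univ.sigma fun i =>
        (Finset.range (N i)).filter fun k => f ⟨i, k⟩ = p := by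
      ext q; simp [hS]
    rw [h2, Finset.sum_sigma]
    simp only [hf, hN]
    rw [hcoeff, zero_mul]
  have hmain : ∀ u : ℝ, combEval s I ε (expVec (x + u • realVec ρ)) =
      ∑ i, s i * (Complex.exp (u * ((I i).tropConst ρ + ε * (I i).tropSlope ρ)) *
        rem i (Real.exp (-u))) := by
    intro u
    rw [← sub_eq_zero, ← hbad u, combEval, ← Finset.sum_sub_distrib]
    refine Finset.sum_congr rfl fun i _ => ?_
    rw [heval, ← mul_sub, ← mul_sub]
    simp only [hrem, sub_sub_cancel, Finset.mul_sum]
    refine Finset.sum_congr rfl fun k _ => ?_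
    have : Complex.exp (u * ((I i).tropConst ρ - k + ε * (I i).tropSlope ρ)) =
        Complex.exp (u * ((I i).tropConst ρ + ε * (I i).tropSlope ρ)) *
          ((Real.exp (-u) : ℝ) : ℂ) ^ k := by
      rw [Complex.ofReal_exp, ← Complex.exp_nat_mul, ← Complex.exp_add]
      congr 1; push_cast; ring
    rw [this]; ring
  simp_rw [hmain]
  refine Asymptotics.IsBigO.fun_sum fun i _ => Asymptotics.IsBigO.const_mul_left ?_ _
  have h1 : (fun u : ℝ => Complex.exp (u * ((I i).tropConst ρ + ε * (I i).tropSlope ρ)))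
      =O[atTop] fun u => Real.exp (u * (((I i).tropConst ρ).re + δ / 2)) := by
    refine Asymptotics.IsBigO.of_bound 1 ?_
    filter_upwards [eventually_ge_atTop 0] with u hu
    rw [Complex.norm_exp, Real.norm_of_nonneg (Real.exp_pos _).le, one_mul]
    refine Real.exp_le_exp.2 ?_
    rw [Complex.re_ofReal_mul, Complex.add_re]
    exact mul_le_mul_of_nonneg_left (by linarith [(abs_le.1 (hε i)).2]) hu
  have h2 : (fun u : ℝ => rem i (Real.exp (-u))) =O[atTop] fun u => Real.exp (-u) ^ N i :=
    (hremO i).comp_tendsto Real.tendsto_exp_neg_atTop_nhds_zero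
  refine (h1.mul h2).trans (Asymptotics.IsBigO.of_bound 1 ?_)
  filter_upwards [eventually_ge_atTop 0] with u hu
  rw [← Real.exp_nat_mul, ← Real.exp_add, Real.norm_of_nonneg (Real.exp_pos _).le,
    Real.norm_of_nonneg (Real.exp_pos _).le, one_mul]
  refine Real.exp_le_exp.2 ?_
  nlinarith [hδN i]

/-- The tropical hypothesis bounds all the exponents at `ε = 0`. -/
theorem NegLeading.re_neg {s : ι → ℂ} {I : ι → EulerIntegrand n} {ρ : Fin n → ℤ}
    (h : NegLeading (trop s I ρ)) : ∀ p ∈ tropExponents s I ρ, p.1.re < 0 := by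
  intro p hp
  have hle : ((p.1.re : ℝ) : EReal) ≤ trop s I ρ 0 := by
    have := le_iSup₂ (f := fun (p : ℂ × ℂ) (_ : p ∈ tropExponents s I ρ) =>
      (((p.1 + ((0 : ℝ) : ℂ) * p.2).re : ℝ) : EReal)) p hp
    simpa [trop] using this
  rcases h with h | ⟨a, ha, r, hr, h⟩
  · rw [h 0] at hle
    exact absurd (le_bot_iff.1 hle) (EReal.coe_ne_bot _)
  · have hr0 : r 0 = 0 := by
      obtain ⟨C, hC⟩ := hr.bound
      simpa using hC.self_of_nhds
    rw [h.self_of_nhds, hr0, add_zero, EReal.coe_le_coe_iff] at hle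
    linarith

/-- Exponential decay of the combination on a cone in logarithmic coordinates. -/
theorem exists_cone_bound {R : Type} [Fintype R] (s : ι → ℂ) (I : ι → EulerIntegrand n)
    (ρ : R → Fin n → ℤ) (hρ : ∀ r i, Even (ρ r i)) (hI : ∀ i, (I i).IsCommonCone ρ)
    (hneg : ∀ r, NegLeading (trop s I (ρ r))) :
    ∃ δ > 0, ∃ C, ∀ᶠ ε in 𝓝 (0 : ℂ), ∀ y : R → ℝ, (∀ r, 0 ≤ y r) →
      ‖combEval s I ε (expVec (∑ r, y r • realVec (ρ r)))‖ ≤ C * Real.exp (-(δ * ∑ r, y r)) := by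
  classical
  refine (hasExpansion_combEval s I ρ hρ hI).exists_bound fun r => ?_
  obtain ⟨δ, hδ, h⟩ := combEval_isBigO s I (ρ r) (hρ r) (hneg r).re_neg
  refine ⟨δ, hδ, ?_⟩
  filter_upwards [h] with ε hε y
  refine (hε (∑ i ∈ Finset.univ.erase r, y i • realVec (ρ i))).congr_left fun u => ?_
  rw [← Finset.sum_erase_add _ _ (Finset.mem_univ r), Function.update_self]
  congr 3
  exact Finset.sum_congr rfl fun i hi => by rw [Function.update_of_ne (Finset.ne_of_mem_erase hi)]

end

/-! ### Pointed rational cones are generated by their rays -/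

section

variable {n : ℕ} {ι : Type*}

open Classical in
/-- The elements of `V` on which the functional `x` is maximal: the vertex set (together with the
other points of `V`) of the face of the convex hull of `V` in the direction `x`. -/
def topExp (V : Finset (Fin n → ℤ)) (x : Fin n → ℝ) : Finset (Fin n → ℤ) :=
  V.filter fun m => ∀ k ∈ V, x ⬝ᵥ realVec k ≤ x ⬝ᵥ realVec m

theorem mem_topExp {V : Finset (Fin n → ℤ)} {x : Fin n → ℝ} {m : Fin n → ℤ} :
    m ∈ topExp V x ↔ m ∈ V ∧ ∀ k ∈ V, x ⬝ᵥ realVec k ≤ x ⬝ᵥ realVec m := by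
  classical
  simp [topExp]

theorem topExp_nonempty {V : Finset (Fin n → ℤ)} (hV : V.Nonempty) (x : Fin n → ℝ) :
    (topExp V x).Nonempty := by
  obtain ⟨m, hm, h⟩ := V.exists_max_image (fun m => x ⬝ᵥ realVec m) hV
  exact ⟨m, mem_topExp.2 ⟨hm, h⟩⟩

/-- The smallest cone of the common normal fan that contains `x`: the functionals that are maximal
wherever `x` is. -/
def coneAt (V : ι → Finset (Fin n → ℤ)) (x : Fin n → ℝ) : Set (Fin n → ℝ) :=
  {ρ | ∀ i, topExp (V i) x ⊆ topExp (V i) ρ}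

theorem mem_coneAt {V : ι → Finset (Fin n → ℤ)} {x ρ : Fin n → ℝ} :
    ρ ∈ coneAt V x ↔ ∀ i, ∀ m ∈ topExp (V i) x, ∀ k ∈ V i, ρ ⬝ᵥ realVec k ≤ ρ ⬝ᵥ realVec m := by
  refine forall_congr' fun i => ⟨fun h m hm => (mem_topExp.1 (h hm)).2, fun h m hm => ?_⟩
  exact mem_topExp.2 ⟨(mem_topExp.1 hm).1, h m hm⟩

theorem self_mem_coneAt (V : ι → Finset (Fin n → ℤ)) (x : Fin n → ℝ) : x ∈ coneAt V x :=
  fun _ => subset_rfl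

theorem coneAt_subset {V : ι → Finset (Fin n → ℤ)} {x z : Fin n → ℝ} (hz : z ∈ coneAt V x) :
    coneAt V z ⊆ coneAt V x := fun _ hρ i => (hz i).trans (hρ i)

theorem smul_mem_coneAt {V : ι → Finset (Fin n → ℤ)} {x ρ : Fin n → ℝ} (hρ : ρ ∈ coneAt V x)
    {c : ℝ} (hc : 0 ≤ c) : c • ρ ∈ coneAt V x := by
  rw [mem_coneAt] at hρ ⊢
  intro i m hm k hk
  rw [smul_dotProduct, smul_dotProduct]
  exact mul_le_mul_of_nonneg_left (hρ i m hm k hk) hc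

/-- Moving from `x` in the direction `-y` inside the cone of `x` one arrives at a point of a proper
face. -/
theorem exists_sub_smul_mem_face [Fintype ι] (V : ι → Finset (Fin n → ℤ)) {x y : Fin n → ℝ}
    (hy : y ∈ coneAt V x) (hy' : -y ∉ coneAt V x) :
    ∃ s : ℝ, 0 ≤ s ∧ x - s • y ∈ coneAt V x ∧
      ∑ i, (topExp (V i) x).card < ∑ i, (topExp (V i) (x - s • y)).card := by
  classical
  -- the cone is defined by the inequalities `0 ≤ g c` for `c ∈ A`; the step `s` is the largest one
  -- that respects those with `0 < g c y`
  set g : (Σ _ : ι, (Fin n → ℤ) × (Fin n → ℤ)) → (Fin n → ℝ) → ℝ := fun c w =>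
    w ⬝ᵥ realVec c.2.1 - w ⬝ᵥ realVec c.2.2 with hg
  set A : Finset (Σ _ : ι, (Fin n → ℤ) × (Fin n → ℤ)) :=
    (Finset.univ.sigma fun i => topExp (V i) x ×ˢ V i) with hA
  have hcone : ∀ w, w ∈ coneAt V x ↔ ∀ c ∈ A, 0 ≤ g c w := by
    intro w
    rw [mem_coneAt]
    refine ⟨fun h c hc => ?_, fun h i m hm k hk => ?_⟩
    · have := Finset.mem_product.1 (Finset.mem_sigma.1 hc).2
      exact sub_nonneg.2 (h c.1 c.2.1 this.1 c.2.2 this.2)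
    · exact sub_nonneg.1 (h ⟨i, m, k⟩ (Finset.mem_sigma.2
        ⟨Finset.mem_univ _, Finset.mem_product.2 ⟨hm, hk⟩⟩))
  have hneg : ∀ c w, g c (-w) = -g c w := fun c w => by simp only [hg, neg_dotProduct]; ring
  have hsub : ∀ c s, g c (x - s • y) = g c x - s * g c y := fun c s => by
    simp only [hg, sub_dotProduct, smul_dotProduct, smul_eq_mul]; ring
  have hne : (A.filter fun c => 0 < g c y).Nonempty := by
    rw [hcone] at hy'
    push Not at hy'
    obtain ⟨c, hc, h⟩ := hy'
    exact ⟨c, Finset.mem_filter.2 ⟨hc, by rw [hneg] at h; linarith⟩⟩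
  obtain ⟨c, hc, hmin⟩ := Finset.exists_min_image _ (fun c => g c x / g c y) hne
  obtain ⟨hcA, hcy⟩ := Finset.mem_filter.1 hc
  have hx := (hcone x).1 (self_mem_coneAt V x)
  have hz : x - (g c x / g c y) • y ∈ coneAt V x := by
    rw [hcone]
    intro d hd
    rw [hsub, sub_nonneg]
    rcases ((hcone y).1 hy d hd).eq_or_lt with h | h
    · rw [← h, mul_zero]; exact hx d hd
    · exact (le_div_iff₀ h).1 (hmin d (Finset.mem_filter.2 ⟨hd, h⟩))
  refine ⟨g c x / g c y, div_nonneg (hx c hcA) hcy.le, hz, ?_⟩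
  have hcm := Finset.mem_product.1 (Finset.mem_sigma.1 hcA).2
  refine Finset.sum_lt_sum (fun i _ => Finset.card_le_card (hz i))
    ⟨c.1, Finset.mem_univ _, Finset.card_lt_card ((Finset.ssubset_iff_of_subset (hz c.1)).2
      ⟨c.2.2, ?_, fun h => ?_⟩)⟩
  · -- the minimizing inequality becomes an equality
    have h0 : g c (x - (g c x / g c y) • y) = 0 := by
      rw [hsub, div_mul_cancel₀ _ hcy.ne', sub_self]
    rw [mem_topExp]
    refine ⟨hcm.2, fun k hk => ?_⟩
    rw [← sub_eq_zero.1 h0]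
    exact mem_coneAt.1 hz c.1 c.2.1 hcm.1 k hk
  · have := mem_coneAt.1 hy c.1 c.2.2 h c.2.1 (mem_topExp.1 hcm.1).1
    simp only [hg] at hcy
    linarith

/-- A pointed polyhedral cone is generated by its rays, stated for the smallest cone around `x` and
a set `𝓡` of vectors that meets every ray. -/
theorem exists_nonneg_combination [Fintype ι] (V : ι → Finset (Fin n → ℤ))
    (hsal : ∀ x, ∀ y ∈ coneAt V x, y ≠ 0 → -y ∉ coneAt V x) (𝓡 : Finset (Fin n → ℤ))
    (h𝓡 : ∀ x : Fin n → ℝ, x ≠ 0 → coneAt V x ⊆ Submodule.span ℝ {x} →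
      ∃ ρ ∈ 𝓡, ∃ c : ℝ, 0 ≤ c ∧ x = c • realVec ρ) (x : Fin n → ℝ) :
    ∃ y : (Fin n → ℤ) → ℝ, (∀ ρ, 0 ≤ y ρ) ∧ (∀ ρ, y ρ ≠ 0 → realVec ρ ∈ coneAt V x) ∧
      x = ∑ ρ ∈ 𝓡, y ρ • realVec ρ := by
  classical
  induction hN : ∑ i, (V i).card - ∑ i, (topExp (V i) x).card using Nat.strong_induction_on
    generalizing x with
  | _ N ih =>
  rcases eq_or_ne x 0 with rfl | hx0
  · exact ⟨0, by simp, by simp, by simp⟩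
  by_cases hray : coneAt V x ⊆ Submodule.span ℝ {x}
  · obtain ⟨ρ, hρ, c, hc, hxc⟩ := h𝓡 x hx0 hray
    have hc0 : c ≠ 0 := by rintro rfl; simp at hxc; exact hx0 hxc
    refine ⟨Pi.single ρ c, fun σ => ?_, fun σ hσ => ?_, ?_⟩
    · rcases eq_or_ne σ ρ with rfl | h <;> simp [*]
    · obtain rfl : σ = ρ := by by_contra h; simp [h] at hσ
      have h1 : realVec σ = c⁻¹ • x := by rw [hxc, smul_smul, inv_mul_cancel₀ hc0, one_smul]
      rw [h1]
      exact smul_mem_coneAt (self_mem_coneAt V x) (inv_nonneg.2 hc)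
    · rw [Finset.sum_eq_single ρ (fun σ _ h => by simp [h]) (fun h => absurd hρ h)]
      simpa using hxc
  obtain ⟨y, hy, hyx⟩ := Set.not_subset.1 hray
  have hle : ∀ z, ∑ i, (topExp (V i) z).card ≤ ∑ i, (V i).card := fun z =>
    Finset.sum_le_sum fun i _ => Finset.card_le_card fun m hm => (mem_topExp.1 hm).1
  have hIH : ∀ z, z ∈ coneAt V x →
      ∑ i, (topExp (V i) x).card < ∑ i, (topExp (V i) z).card →
      ∃ y : (Fin n → ℤ) → ℝ, (∀ ρ, 0 ≤ y ρ) ∧ (∀ ρ, y ρ ≠ 0 → realVec ρ ∈ coneAt V x) ∧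
        z = ∑ ρ ∈ 𝓡, y ρ • realVec ρ := by
    intro z hz hlt
    obtain ⟨y, h1, h2, h3⟩ := ih _ (by have := hle z; omega) z rfl
    exact ⟨y, h1, fun ρ hρ => coneAt_subset hz (h2 ρ hρ), h3⟩
  -- `x` is a nonnegative combination of two points `x - s • y` and `x - s' • (x - s • y)` on proper
  -- faces
  have hy0 : y ≠ 0 := by rintro rfl; exact hyx (Submodule.zero_mem _)
  obtain ⟨s, hs, hz, hzlt⟩ := exists_sub_smul_mem_face V hy (hsal x y hy hy0)
  have hz0 : x - s • y ≠ 0 := by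
    intro h
    rcases hs.eq_or_lt with rfl | hs
    · simp at h; exact hx0 h
    · refine hyx (Submodule.mem_span_singleton.2 ⟨s⁻¹, ?_⟩)
      rw [sub_eq_zero.1 h, smul_smul, inv_mul_cancel₀ hs.ne', one_smul]
  obtain ⟨s', hs', hz', hzlt'⟩ := exists_sub_smul_mem_face V hz (hsal x _ hz hz0)
  obtain ⟨a, ha, ha', hxa⟩ := hIH _ hz hzlt
  obtain ⟨b, hb, hb', hxb⟩ := hIH _ hz' hzlt'
  refine ⟨fun ρ => b ρ + s' * a ρ, fun ρ => add_nonneg (hb ρ) (mul_nonneg hs' (ha ρ)),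
    fun ρ hρ => ?_, ?_⟩
  · by_cases h : b ρ = 0
    · exact ha' ρ fun h' => hρ (by simp [h, h'])
    · exact hb' ρ h
  · simp only [add_smul, mul_smul, Finset.sum_add_distrib, ← Finset.smul_sum]
    rw [← hxa, ← hxb]
    simp

/-- The rays of the fan are rational: they contain even integer vectors. -/
theorem exists_even_realVec_mem_ray [Finite ι] (V : ι → Finset (Fin n → ℤ)) {x : Fin n → ℝ}
    (hx : x ≠ 0) (hray : coneAt V x ⊆ Submodule.span ℝ {x}) :
    ∃ ρ : Fin n → ℤ, ρ ≠ 0 ∧ (∀ i, Even (ρ i)) ∧ realVec ρ ∈ coneAt V x := by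
  -- a `ℚ`-linear image of the coordinates of `x` satisfies the same integral equations as `x`
  obtain ⟨i₀, hi₀⟩ := Function.ne_iff.1 hx
  obtain ⟨φ, hφ⟩ : ∃ φ : Module.Dual ℚ ℝ, φ (x i₀) ≠ 0 := by
    by_contra! h
    exact hi₀ ((Module.forall_dual_apply_eq_zero_iff ℚ _).1 h)
  set w : Fin n → ℝ := fun i => (φ (x i) : ℝ) with hw
  have hφdot : ∀ m, w ⬝ᵥ realVec m = (φ (x ⬝ᵥ realVec m) : ℝ) := by
    intro m
    simp only [dotProduct, hw, realVec, map_sum]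
    push_cast
    refine Finset.sum_congr rfl fun i _ => ?_
    have : x i * (m i : ℝ) = (m i : ℚ) • x i := by
      rw [Rat.smul_def]; push_cast; ring
    rw [this, map_smul]
    simp [mul_comm]
  have hmove : ∀ᶠ δ in 𝓝 (0 : ℝ), x + δ • w ∈ coneAt V x := by
    simp only [mem_coneAt]
    refine eventually_all.2 fun i => (Finset.eventually_all _).2 fun m hm =>
      (Finset.eventually_all _).2 fun k hk => ?_
    simp only [add_dotProduct, smul_dotProduct, smul_eq_mul]
    have hmx := mem_topExp.1 hm
    rcases (hmx.2 k hk).eq_or_lt with h | h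
    · refine Eventually.of_forall fun δ => ?_
      rw [hφdot, hφdot, h]
    · have h1 : ContinuousAt (fun δ : ℝ => x ⬝ᵥ realVec k + δ * (w ⬝ᵥ realVec k)) 0 := by fun_prop
      have h2 : ContinuousAt (fun δ : ℝ => x ⬝ᵥ realVec m + δ * (w ⬝ᵥ realVec m)) 0 := by fun_prop
      exact (h1.eventually_lt h2 (by simpa using h)).mono fun _ => le_of_lt
  obtain ⟨δ, hδ, hδ0⟩ := ((hmove.filter_mono nhdsWithin_le_nhds).and
    (self_mem_nhdsWithin (a := (0 : ℝ)) (s := Set.Ioi 0))).exists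
  have hwx : w ∈ Submodule.span ℝ {x} := by
    have h1 : δ • w ∈ Submodule.span ℝ {x} := by
      have := Submodule.sub_mem _ (hray hδ) (Submodule.mem_span_singleton_self x)
      simpa using this
    have h2 := Submodule.smul_mem _ δ⁻¹ h1
    rwa [smul_smul, inv_mul_cancel₀ (ne_of_gt hδ0), one_smul] at h2
  obtain ⟨c, hc⟩ := Submodule.mem_span_singleton.1 hwx
  have hw0 : w i₀ ≠ 0 := by simpa [hw] using hφ
  have hc0 : c ≠ 0 := by rintro rfl; rw [← hc] at hw0; simp at hw0
  -- clear denominators and fix the sign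
  set D : ℕ := ∏ i, (φ (x i)).den with hD
  have hDpos : 0 < D := Finset.prod_pos fun i _ => (φ (x i)).den_pos
  have hint : ∀ i, ∃ a : ℤ, (a : ℝ) = D * w i := by
    intro i
    obtain ⟨e, he⟩ := Finset.dvd_prod_of_mem (fun i => (φ (x i)).den) (Finset.mem_univ i)
    refine ⟨e * (φ (x i)).num, ?_⟩
    have h1 : (D : ℚ) * φ (x i) = ((e * (φ (x i)).num : ℤ) : ℚ) := by
      have h2 := Rat.mul_den_eq_num (φ (x i))
      rw [hD, he]; push_cast
      rw [← h2]; ring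
    have h3 := congrArg (fun q : ℚ => (q : ℝ)) h1
    simp only [hw]
    push_cast at h3 ⊢
    exact h3.symm
  choose a ha using hint
  set ρ : Fin n → ℤ := fun i => 2 * (SignType.sign c : ℤ) * a i with hρ
  have hρx : realVec ρ = (2 * |c| * D) • x := by
    funext i
    have h1 : w i = c * x i := by rw [← hc]; simp
    have h2 : (SignType.sign c : ℝ) * c = |c| := sign_mul_self c
    simp only [realVec, hρ, Pi.smul_apply, smul_eq_mul]
    push_cast
    rw [ha, h1, ← h2]; ring
  refine ⟨ρ, fun h => ?_, fun i => ⟨(SignType.sign c : ℤ) * a i, by simp only [hρ]; ring⟩, ?_⟩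
  · have h1 : (realVec ρ) i₀ = 0 := by rw [h]; simp [realVec]
    rw [hρx] at h1
    simp only [Pi.smul_apply, smul_eq_mul, mul_eq_zero] at h1
    have h2 : (D : ℝ) ≠ 0 := by exact_mod_cast hDpos.ne'
    rcases h1 with ((h1 | h1) | h1) | h1
    · norm_num at h1
    · exact hc0 (abs_eq_zero.1 h1)
    · exact h2 h1
    · exact hi₀ h1
  · rw [hρx]
    exact smul_mem_coneAt (self_mem_coneAt V x) (by positivity)

end

/-! ### The common refinement of the normal fans -/

section

variable {n : ℕ} {ι : Type*}

/-- Polynomials with nonnegative coefficients multiply without cancellation: the exponents of a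
product are exactly the sums of exponents of the factors. -/
theorem mem_support_prod {κ : Type*} (P : κ → Laurent n) (hP : ∀ j k, 0 ≤ (P j).coeff k)
    (s : Finset κ) :
    (∀ k, 0 ≤ (∏ j ∈ s, P j).coeff k) ∧ ∀ m, m ∈ (∏ j ∈ s, P j).coeff.support ↔
      ∃ f : κ → Fin n → ℤ, (∀ j ∈ s, f j ∈ (P j).coeff.support) ∧ m = ∑ j ∈ s, f j := by
  classical
  induction s using Finset.induction_on with
  | empty =>
    simp only [Finset.prod_empty, Finset.notMem_empty, Finset.sum_empty]
    constructor
    · intro k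
      rw [AddMonoidAlgebra.one_def, AddMonoidAlgebra.coeff_single, Finsupp.single_apply]
      split_ifs <;> simp
    · intro m
      rw [AddMonoidAlgebra.one_def, AddMonoidAlgebra.coeff_single, Finsupp.mem_support_iff,
        Finsupp.single_apply]
      simp [eq_comm]
  | insert a s ha ih =>
    obtain ⟨ih1, ih2⟩ := ih
    rw [Finset.prod_insert ha]
    have hterm : ∀ m k l, 0 ≤ if k + l = m then
        (P a).coeff k * (∏ j ∈ s, P j).coeff l else 0 := fun m k l => by
      split_ifs
      · exact mul_nonneg (hP a k) (ih1 l)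
      · exact le_rfl
    refine ⟨fun m => ?_, fun m => ?_⟩
    · rw [AddMonoidAlgebra.coeff_mul]
      exact Finset.sum_nonneg fun k _ => Finset.sum_nonneg fun l _ => hterm m k l
    · rw [Finsupp.mem_support_iff, AddMonoidAlgebra.coeff_mul]
      constructor
      · intro h
        obtain ⟨k, hk, h1⟩ := Finset.exists_ne_zero_of_sum_ne_zero h
        obtain ⟨l, hl, h2⟩ := Finset.exists_ne_zero_of_sum_ne_zero h1
        have hkl : k + l = m := by by_contra h3; simp [h3] at h2
        obtain ⟨f, hf, rfl⟩ := (ih2 l).1 hl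
        refine ⟨Function.update f a k, fun j hj => ?_, ?_⟩
        · rcases eq_or_ne j a with rfl | hja
          · simpa using hk
          · rw [Function.update_of_ne hja]
            exact hf j ((Finset.mem_insert.1 hj).resolve_left hja)
        · rw [Finset.sum_insert ha, Function.update_self, ← hkl]
          congr 1
          exact Finset.sum_congr rfl fun j hj =>
            (Function.update_of_ne (ne_of_mem_of_not_mem hj ha) k f).symm
      · rintro ⟨f, hf, rfl⟩
        rw [Finset.sum_insert ha]
        have hk := hf a (Finset.mem_insert_self a s)
        have hl := (ih2 _).2 ⟨f, fun j hj => hf j (Finset.mem_insert_of_mem hj), rfl⟩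
        refine ne_of_gt (Finset.sum_pos' (fun k _ => Finset.sum_nonneg fun l _ => hterm _ k l)
          ⟨f a, hk, Finset.sum_pos' (fun l _ => hterm _ _ l) ⟨_, hl, ?_⟩⟩)
        simp only [if_true]
        exact mul_pos (lt_of_le_of_ne (hP _ _) (Finsupp.mem_support_iff.1 hk).symm)
          (lt_of_le_of_ne (ih1 _) (Finsupp.mem_support_iff.1 hl).symm)

namespace EulerIntegrand

/-- The exponents of the product of the polynomials of `I`. -/
def exps (I : EulerIntegrand n) : Finset (Fin n → ℤ) := (∏ j, I.P j).coeff.support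

theorem mem_exps (I : EulerIntegrand n) {m : Fin n → ℤ} :
    m ∈ I.exps ↔ ∃ f : Fin I.m → Fin n → ℤ, (∀ j, f j ∈ (I.P j).coeff.support) ∧
      m = ∑ j, f j := by
  simpa [exps] using (mem_support_prod I.P I.P_nonneg Finset.univ).2 m

theorem exps_nonempty (I : EulerIntegrand n) : I.exps.Nonempty := by
  choose f hf using I.support_nonempty
  exact ⟨_, I.mem_exps.2 ⟨f, hf, rfl⟩⟩

/-- On a cone of the normal fan of the Newton polytope all the `Trop P_j` are linear. -/
theorem isCommonCone_of_mem_coneAt {R : Type} (I : ι → EulerIntegrand n) (x : Fin n → ℝ)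
    (ρ : R → Fin n → ℤ) (hρ : ∀ r, realVec (ρ r) ∈ coneAt (fun i => (I i).exps) x) (i : ι) :
    (I i).IsCommonCone ρ := by
  classical
  obtain ⟨m, hm⟩ := topExp_nonempty (I i).exps_nonempty x
  obtain ⟨f, hf, hmf⟩ := (I i).mem_exps.1 (mem_topExp.1 hm).1
  refine fun j => ⟨f j, hf j, fun r => le_antisymm ?_ ((I i).le_tropPoly _ (hf j))⟩
  obtain ⟨k, hk, hkt⟩ := (I i).exists_tropPoly_eq (ρ r) j
  -- exchange the `j`-th summand of the maximizer `m = ∑ j, f j`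
  have hmem : ∑ l, Function.update f j k l ∈ (I i).exps := (I i).mem_exps.2
    ⟨Function.update f j k, fun l => by
      rcases eq_or_ne l j with rfl | h
      · simpa using hk
      · rw [Function.update_of_ne h]; exact hf l, rfl⟩
  have h1 := mem_coneAt.1 (hρ r) i m hm _ hmem
  rw [realVec_dotProduct, realVec_dotProduct, Int.cast_le, hmf,
    ← Finset.sum_erase_add _ _ (Finset.mem_univ j),
    ← Finset.sum_erase_add _ f (Finset.mem_univ j), Function.update_self,
    Finset.sum_congr rfl fun l hl => Function.update_of_ne (Finset.ne_of_mem_erase hl) k f,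
    dotProduct_add, dotProduct_add] at h1
  rw [hkt]
  linarith

end EulerIntegrand

theorem dotProduct_le_of_mem_convexHull {V : Finset (Fin n → ℤ)} {x : Fin n → ℝ} {c : ℝ}
    (h : ∀ m ∈ V, x ⬝ᵥ realVec m ≤ c) {z : Fin n → ℝ}
    (hz : z ∈ convexHull ℝ (realVec '' (V : Set (Fin n → ℤ)))) : x ⬝ᵥ z ≤ c := by
  have hconv : Convex ℝ {z : Fin n → ℝ | x ⬝ᵥ z ≤ c} := by
    intro a ha b hb s t hs ht hst
    simp only [Set.mem_ofPred_eq, dotProduct_add, dotProduct_smul, smul_eq_mul] at *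
    calc s * (x ⬝ᵥ a) + t * (x ⬝ᵥ b) ≤ s * c + t * c := by gcongr
      _ = c := by rw [← add_mul, hst, one_mul]
  refine convexHull_min ?_ hconv hz
  rintro _ ⟨m, hm, rfl⟩
  exact h m hm

/-- The face of `Q` on which the functional `x` is maximal. -/
def faceAt (Q : Set (Fin n → ℝ)) (x : Fin n → ℝ) : Set (Fin n → ℝ) :=
  {z ∈ Q | ∀ y ∈ Q, x ⬝ᵥ y ≤ x ⬝ᵥ z}

theorem realVec_mem_faceAt {V : Finset (Fin n → ℤ)} {x : Fin n → ℝ} {m : Fin n → ℤ}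
    (hm : m ∈ topExp V x) :
    realVec m ∈ faceAt (convexHull ℝ (realVec '' (V : Set (Fin n → ℤ)))) x := by
  obtain ⟨h1, h2⟩ := mem_topExp.1 hm
  exact ⟨subset_convexHull _ _ ⟨m, h1, rfl⟩, fun y hy => dotProduct_le_of_mem_convexHull h2 hy⟩

/-- The normal cone of a face is determined by the points of `V` on that face. -/
theorem mem_normalCone_faceAt {V : Finset (Fin n → ℤ)} (hV : V.Nonempty) {x ρ : Fin n → ℝ} :
    ρ ∈ normalCone (convexHull ℝ (realVec '' (V : Set (Fin n → ℤ))))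
        (faceAt (convexHull ℝ (realVec '' (V : Set (Fin n → ℤ)))) x) ↔
      ∀ m ∈ topExp V x, ∀ k ∈ V, ρ ⬝ᵥ realVec k ≤ ρ ⬝ᵥ realVec m := by
  constructor
  · intro h m hm k hk
    exact h _ (realVec_mem_faceAt hm) _ (subset_convexHull _ _ ⟨k, hk, rfl⟩)
  · intro h z hz y hy
    obtain ⟨m, hm⟩ := topExp_nonempty hV x
    obtain ⟨hmV, hmx⟩ := mem_topExp.1 hm
    -- for large `T` the functional `T • x - ρ` is also maximal at `m`, and `x` is constant on
    -- the face
    obtain ⟨T, hT⟩ : ∃ T : ℝ, ∀ k ∈ V,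
        ρ ⬝ᵥ realVec m - ρ ⬝ᵥ realVec k ≤ T * (x ⬝ᵥ realVec m - x ⬝ᵥ realVec k) := by
      have : ∀ᶠ T : ℝ in atTop, ∀ k ∈ V,
          ρ ⬝ᵥ realVec m - ρ ⬝ᵥ realVec k ≤ T * (x ⬝ᵥ realVec m - x ⬝ᵥ realVec k) := by
        refine (Finset.eventually_all _).2 fun k hk => ?_
        rcases (hmx k hk).eq_or_lt with h1 | h1
        · have hk' : k ∈ topExp V x := mem_topExp.2 ⟨hk, fun l hl => h1 ▸ hmx l hl⟩
          refine Eventually.of_forall fun T => ?_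
          rw [h1, sub_self, mul_zero]
          exact sub_nonpos.2 (h k hk' m hmV)
        · exact (tendsto_id.atTop_mul_const (sub_pos.2 h1)).eventually_ge_atTop _
      exact this.exists
    have h1 : (T • x - ρ) ⬝ᵥ z ≤ T * (x ⬝ᵥ realVec m) - ρ ⬝ᵥ realVec m := by
      refine dotProduct_le_of_mem_convexHull (fun k hk => ?_) hz.1
      rw [sub_dotProduct, smul_dotProduct, smul_eq_mul]
      linarith [hT k hk]
    have h2 : x ⬝ᵥ realVec m = x ⬝ᵥ z := le_antisymm
      (hz.2 _ (subset_convexHull _ _ ⟨m, hmV, rfl⟩)) ((realVec_mem_faceAt hm).2 z hz.1)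
    rw [sub_dotProduct, smul_dotProduct, smul_eq_mul, h2] at h1
    have h3 := dotProduct_le_of_mem_convexHull (h m hm) hy
    linarith

theorem exists_eq_faceAt {Q F : Set (Fin n → ℝ)} (hne : F.Nonempty) (hF : IsExposed ℝ Q F) :
    ∃ x, F = faceAt Q x := by
  obtain ⟨l, rfl⟩ := hF hne
  have hl : ∀ z, l z = (fun i => l (Pi.single i 1)) ⬝ᵥ z := by
    intro z
    rw [dotProduct]
    conv_lhs => rw [pi_eq_sum_univ' z, map_sum]
    refine Finset.sum_congr rfl fun i _ => ?_
    rw [map_smul, smul_eq_mul, mul_comm]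
  refine ⟨fun i => l (Pi.single i 1), ?_⟩
  simp only [faceAt, ← hl]

theorem isExposed_faceAt (Q : Set (Fin n → ℝ)) (x : Fin n → ℝ) : IsExposed ℝ Q (faceAt Q x) := by
  intro _
  refine ⟨∑ i, x i • ContinuousLinearMap.proj (R := ℝ) i, ?_⟩
  simp [faceAt, dotProduct]

theorem finite_normalFan {V : Finset (Fin n → ℤ)} (hV : V.Nonempty) :
    (normalFan (convexHull ℝ (realVec '' (V : Set (Fin n → ℤ))))).Finite := by
  set Q := convexHull ℝ (realVec '' (V : Set (Fin n → ℤ))) with hQ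
  refine ((V.powerset.finite_toSet).image fun T : Finset (Fin n → ℤ) =>
    normalCone Q (realVec '' (T : Set (Fin n → ℤ)))).subset ?_
  rintro σ ⟨F, hne, hF, rfl⟩
  obtain ⟨x, rfl⟩ := exists_eq_faceAt hne hF
  refine ⟨topExp V x, ?_, ?_⟩
  · exact Finset.mem_coe.2 (Finset.mem_powerset.2 fun m hm => (mem_topExp.1 hm).1)
  · ext ρ
    rw [mem_normalCone_faceAt hV]
    constructor
    · intro h m hm k hk
      exact h _ ⟨m, hm, rfl⟩ _ (subset_convexHull _ _ ⟨k, hk, rfl⟩)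
    · rintro h _ ⟨m, hm, rfl⟩ y hy
      exact dotProduct_le_of_mem_convexHull (h m hm) hy

theorem finite_combFan [Finite ι] (I : ι → EulerIntegrand n) : (combFan I).Finite := by
  refine ((Set.Finite.pi' fun i => finite_normalFan (I i).exps_nonempty).image
    fun τ => ⨅ i, τ i).subset ?_
  rintro σ ⟨τ, hτ, rfl⟩
  exact ⟨τ, hτ, rfl⟩

/-- The cone of `x` is a cone of the common refinement. -/
theorem exists_combFan_eq_coneAt (I : ι → EulerIntegrand n) (x : Fin n → ℝ) :
    ∃ σ ∈ combFan I, (σ : Set (Fin n → ℝ)) = coneAt (fun i => (I i).exps) x := by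
  refine ⟨⨅ i, normalCone (I i).newt (faceAt (I i).newt x), ⟨_, fun i => ⟨_, ?_,
    isExposed_faceAt _ x, rfl⟩, rfl⟩, ?_⟩
  · obtain ⟨m, hm⟩ := topExp_nonempty (I i).exps_nonempty x
    exact ⟨_, realVec_mem_faceAt hm⟩
  · ext ρ
    rw [mem_coneAt, SetLike.mem_coe, Submodule.mem_iInf]
    exact forall_congr' fun i => mem_normalCone_faceAt (I i).exps_nonempty

/-- Finitely many even integer vectors, one on each ray, generate all cones of a pointed fan. -/
theorem exists_ray_generators [Fintype ι] (I : ι → EulerIntegrand n)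
    (hpointed : FanPointed (combFan I)) :
    ∃ 𝓡 : Finset (Fin n → ℤ), (∀ ρ ∈ 𝓡, ρ ≠ 0 ∧ (∀ i, Even (ρ i)) ∧
        ∃ σ ∈ fanDim (combFan I) 1, realVec ρ ∈ σ) ∧
      ∀ x : Fin n → ℝ, ∃ y : (Fin n → ℤ) → ℝ, (∀ ρ, 0 ≤ y ρ) ∧
        (∀ ρ, y ρ ≠ 0 → realVec ρ ∈ coneAt (fun i => (I i).exps) x) ∧
        x = ∑ ρ ∈ 𝓡, y ρ • realVec ρ := by
  classical
  have hsal : ∀ x, ∀ y ∈ coneAt (fun i => (I i).exps) x, y ≠ 0 →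
      -y ∉ coneAt (fun i => (I i).exps) x := by
    intro x y hy hy0
    obtain ⟨σ, hσ, hσx⟩ := exists_combFan_eq_coneAt I x
    rw [← hσx] at hy ⊢
    exact hpointed σ hσ y hy hy0
  have hfin : (fanDim (combFan I) 1).Finite := (finite_combFan I).subset fun σ hσ => hσ.1
  have hex : ∀ σ : PointedCone ℝ (Fin n → ℝ), ∃ ρ : Fin n → ℤ,
      (∃ ρ : Fin n → ℤ, ρ ≠ 0 ∧ (∀ i, Even (ρ i)) ∧ realVec ρ ∈ σ) →
      ρ ≠ 0 ∧ (∀ i, Even (ρ i)) ∧ realVec ρ ∈ σ := by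
    intro σ
    by_cases h : ∃ ρ : Fin n → ℤ, ρ ≠ 0 ∧ (∀ i, Even (ρ i)) ∧ realVec ρ ∈ σ
    · exact ⟨h.choose, fun _ => h.choose_spec⟩
    · exact ⟨0, fun h' => absurd h' h⟩
  choose gen hgen using hex
  refine ⟨(hfin.toFinset.filter fun σ =>
    ∃ ρ : Fin n → ℤ, ρ ≠ 0 ∧ (∀ i, Even (ρ i)) ∧ realVec ρ ∈ σ).image gen, ?_, ?_⟩
  · intro ρ hρ
    obtain ⟨σ, hσ, rfl⟩ := Finset.mem_image.1 hρ
    obtain ⟨h1, h2⟩ := Finset.mem_filter.1 hσ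
    obtain ⟨h3, h4, h5⟩ := hgen σ h2
    exact ⟨h3, h4, σ, hfin.mem_toFinset.1 h1, h5⟩
  · refine exists_nonneg_combination _ hsal _ fun x hx hray => ?_
    obtain ⟨σ, hσ, hσx⟩ := exists_combFan_eq_coneAt I x
    have hdim : coneDim σ = 1 := by
      have : Submodule.span ℝ (σ : Set (Fin n → ℝ)) = Submodule.span ℝ {x} := by
        rw [hσx]
        refine le_antisymm (Submodule.span_le.2 hray) (Submodule.span_mono ?_)
        exact Set.singleton_subset_iff.2 (self_mem_coneAt _ x)
      rw [coneDim, this, finrank_span_singleton hx]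
    have hexρ : ∃ ρ : Fin n → ℤ, ρ ≠ 0 ∧ (∀ i, Even (ρ i)) ∧ realVec ρ ∈ σ := by
      obtain ⟨ρ, h1, h2, h3⟩ := exists_even_realVec_mem_ray _ hx hray
      rw [← hσx] at h3
      exact ⟨ρ, h1, h2, h3⟩
    obtain ⟨h1, -, h3⟩ := hgen σ hexρ
    have h3' : realVec (gen σ) ∈ coneAt (fun i => (I i).exps) x := hσx ▸ h3
    obtain ⟨c, hc⟩ := Submodule.mem_span_singleton.1 (hray h3')
    have hc0 : c ≠ 0 := by
      rintro rfl
      rw [zero_smul] at hc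
      exact h1 (funext fun i => by simpa [realVec] using (congrFun hc i).symm)
    have hcpos : 0 < c := by
      refine lt_of_le_of_ne (not_lt.1 fun hneg => ?_) hc0.symm
      refine hsal x x (self_mem_coneAt _ x) hx ?_
      have h4 := smul_mem_coneAt h3' (inv_nonneg.2 (neg_nonneg.2 hneg.le))
      rwa [← hc, smul_smul, inv_neg, neg_mul, inv_mul_cancel₀ hc0, neg_one_smul] at h4
    refine ⟨gen σ, Finset.mem_image_of_mem _ (Finset.mem_filter.2
      ⟨hfin.mem_toFinset.2 ⟨hσ, hdim⟩, hexρ⟩), c⁻¹, inv_nonneg.2 hcpos.le, ?_⟩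
    rw [← hc, smul_smul, inv_mul_cancel₀ hc0, one_smul]

/-- Exponential decay of the combination in all directions, in logarithmic coordinates. -/
theorem exists_uniform_bound [Fintype ι] (s : ι → ℂ) (I : ι → EulerIntegrand n)
    (hpointed : FanPointed (combFan I))
    (hneg : ∀ σ ∈ fanDim (combFan I) 1, ∀ ρ : Fin n → ℤ, ρ ≠ 0 →
      realVec ρ ∈ σ → NegLeading (trop s I ρ)) :
    ∃ δ > 0, ∃ C, ∀ᶠ ε in 𝓝 (0 : ℂ), ∀ x : Fin n → ℝ,
      ‖combEval s I ε (expVec x)‖ ≤ C * Real.exp (-(δ * ∑ i, |x i|)) := by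
  classical
  obtain ⟨𝓡, h𝓡, hgen⟩ := exists_ray_generators I hpointed
  -- one bound for each subset of the generators that lies in a common cone
  have hT : ∀ T : 𝓡.powerset, ∃ δ > 0, ∃ C ≥ 0, ∀ᶠ ε in 𝓝 (0 : ℂ),
      (∀ i, (I i).IsCommonCone fun ρ : T.1 => ρ.1) → ∀ y : T.1 → ℝ, (∀ r, 0 ≤ y r) →
      ‖combEval s I ε (expVec (∑ r, y r • realVec r.1))‖ ≤ C * Real.exp (-(δ * ∑ r, y r)) := by
    intro T
    have hsub : ∀ r : T.1, r.1 ∈ 𝓡 := fun r => Finset.mem_powerset.1 T.2 r.2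
    by_cases hI : ∀ i, (I i).IsCommonCone fun ρ : T.1 => ρ.1
    · obtain ⟨δ, hδ, C, h⟩ := exists_cone_bound s I (fun ρ : T.1 => ρ.1)
        (fun r => (h𝓡 r.1 (hsub r)).2.1) hI fun r => by
          obtain ⟨h1, -, σ, hσ, h3⟩ := h𝓡 r.1 (hsub r)
          exact hneg σ hσ r.1 h1 h3
      refine ⟨δ, hδ, max C 0, le_max_right _ _, h.mono fun ε hε _ y hy => (hε y hy).trans ?_⟩
      exact mul_le_mul_of_nonneg_right (le_max_left _ _) (Real.exp_pos _).le
    · exact ⟨1, one_pos, 0, le_rfl, Eventually.of_forall fun _ h => absurd h hI⟩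
  choose δ hδ C hC hbound using hT
  obtain ⟨d, hd, hdT⟩ := exists_pos_forall_le δ hδ
  set B : ℝ := 1 + ∑ ρ ∈ 𝓡, ∑ i, |realVec ρ i| with hB
  have hBρ : ∀ ρ ∈ 𝓡, ∑ i, |realVec ρ i| ≤ B := fun ρ hρ => by
    have := Finset.single_le_sum (f := fun ρ => ∑ i, |realVec ρ i|)
      (fun ρ _ => Finset.sum_nonneg fun i _ => abs_nonneg _) hρ
    linarith
  have hBpos : 0 < B := by
    have : 0 ≤ ∑ ρ ∈ 𝓡, ∑ i, |realVec ρ i| :=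
      Finset.sum_nonneg fun ρ _ => Finset.sum_nonneg fun i _ => abs_nonneg _
    linarith
  refine ⟨d / B, div_pos hd hBpos, ∑ T, C T, ?_⟩
  filter_upwards [eventually_all.2 hbound] with ε hε x
  obtain ⟨y, hy0, hycone, hxy⟩ := hgen x
  set T : 𝓡.powerset := ⟨𝓡.filter fun ρ => realVec ρ ∈ coneAt (fun i => (I i).exps) x,
    Finset.mem_powerset.2 (Finset.filter_subset _ _)⟩ with hTdef
  have hTcone : ∀ i, (I i).IsCommonCone fun ρ : T.1 => ρ.1 :=
    EulerIntegrand.isCommonCone_of_mem_coneAt I x _ fun r => (Finset.mem_filter.1 r.2).2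
  have hxT : x = ∑ r : T.1, y r.1 • realVec r.1 := by
    rw [Finset.sum_coe_sort T.1 fun ρ => y ρ • realVec ρ]
    simp only [hTdef]
    rw [Finset.sum_filter_of_ne fun ρ _ h => hycone ρ fun h0 => h (by rw [h0, zero_smul])]
    exact hxy
  have h1 := hε T hTcone (fun r => y r.1) fun r => hy0 _
  rw [← hxT] at h1
  have hsum : ∑ i, |x i| ≤ B * ∑ r : T.1, y r.1 := by
    calc ∑ i, |x i| ≤ ∑ i, ∑ r : T.1, y r.1 * |realVec r.1 i| := by
          refine Finset.sum_le_sum fun i _ => ?_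
          conv_lhs => rw [hxT]
          rw [Finset.sum_apply]
          refine (Finset.abs_sum_le_sum_abs _ _).trans (le_of_eq ?_)
          refine Finset.sum_congr rfl fun r _ => ?_
          rw [Pi.smul_apply, smul_eq_mul, abs_mul, abs_of_nonneg (hy0 _)]
      _ = ∑ r : T.1, y r.1 * ∑ i, |realVec r.1 i| := by
          rw [Finset.sum_comm]
          exact Finset.sum_congr rfl fun r _ => (Finset.mul_sum _ _ _).symm
      _ ≤ ∑ r : T.1, y r.1 * B := Finset.sum_le_sum fun r _ => mul_le_mul_of_nonneg_left
          (hBρ r.1 (Finset.mem_filter.1 r.2).1) (hy0 _)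
      _ = B * ∑ r : T.1, y r.1 := by rw [← Finset.sum_mul, mul_comm]
  refine h1.trans (mul_le_mul ?_ ?_ (Real.exp_pos _).le (Finset.sum_nonneg fun T _ => hC T))
  · exact Finset.single_le_sum (fun T _ => hC T) (Finset.mem_univ T)
  · refine Real.exp_le_exp.2 (neg_le_neg ?_)
    have hy : 0 ≤ ∑ r : T.1, y r.1 := Finset.sum_nonneg fun r _ => hy0 _
    calc d / B * ∑ i, |x i| ≤ d / B * (B * ∑ r : T.1, y r.1) :=
          mul_le_mul_of_nonneg_left hsum (div_pos hd hBpos).le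
      _ = d * ∑ r : T.1, y r.1 := by field_simp
      _ ≤ δ T * ∑ r : T.1, y r.1 := mul_le_mul_of_nonneg_right (hdT T) hy

end

/-! ### Integration and Taylor expansion -/

section

/-- One step of differentiation under the integral sign for a dominated family of holomorphic
functions; the Cauchy estimate dominates the derivative on a smaller disc. -/
theorem hasDerivAt_integral_of_holomorphic {X : Type*} [MeasurableSpace X] {μ : Measure X}
    {f : ℂ → X → ℂ} {b : X → ℝ} {R : ℝ} (hR : 0 < R) (hb : Integrable b μ)
    (hmeas : ∀ ε ∈ Metric.ball (0 : ℂ) R, AEStronglyMeasurable (f ε) μ)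
    (hdiff : ∀ᵐ x ∂μ, DifferentiableOn ℂ (fun ε => f ε x) (Metric.ball 0 R))
    (hbound : ∀ᵐ x ∂μ, ∀ ε ∈ Metric.ball (0 : ℂ) R, ‖f ε x‖ ≤ b x) :
    (∀ᵐ x ∂μ, ∀ ε ∈ Metric.ball (0 : ℂ) (R / 2),
      ‖deriv (fun ε => f ε x) ε‖ ≤ b x / (R / 4)) ∧
    ∀ ε ∈ Metric.ball (0 : ℂ) (R / 2),
      AEStronglyMeasurable (fun x => deriv (fun ε => f ε x) ε) μ ∧
      HasDerivAt (fun ε => ∫ x, f ε x ∂μ) (∫ x, deriv (fun ε => f ε x) ε ∂μ) ε := by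
  have hsub : ∀ ε ∈ Metric.ball (0 : ℂ) (R / 2), Metric.closedBall ε (R / 4) ⊆
      Metric.ball 0 R := by
    intro ε hε z hz
    rw [Metric.mem_ball] at hε ⊢
    rw [Metric.mem_closedBall] at hz
    linarith [dist_triangle z ε 0]
  have hderiv : ∀ᵐ x ∂μ, ∀ ε ∈ Metric.ball (0 : ℂ) (R / 2),
      HasDerivAt (fun ε => f ε x) (deriv (fun ε => f ε x) ε) ε := by
    filter_upwards [hdiff] with x hx ε hε
    exact (hx.differentiableAt (Metric.isOpen_ball.mem_nhds
      (Metric.ball_subset_ball (by linarith) hε))).hasDerivAt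
  have hbd : ∀ᵐ x ∂μ, ∀ ε ∈ Metric.ball (0 : ℂ) (R / 2),
      ‖deriv (fun ε => f ε x) ε‖ ≤ b x / (R / 4) := by
    filter_upwards [hdiff, hbound] with x hx hbx ε hε
    exact Complex.norm_deriv_le_of_forall_mem_sphere_norm_le (by positivity)
      (hx.diffContOnCl_ball (hsub ε hε))
      fun z hz => hbx z (hsub ε hε (Metric.sphere_subset_closedBall hz))
  refine ⟨hbd, fun ε hε => ?_⟩
  have hmeas' : AEStronglyMeasurable (fun x => deriv (fun ε => f ε x) ε) μ := by
    -- the derivative is a limit of difference quotients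
    set h : ℕ → ℂ := fun k => ε + ((R / 4 / (k + 1) : ℝ) : ℂ) with hh
    have hmem : ∀ k, h k ∈ Metric.ball (0 : ℂ) R := by
      intro k
      refine hsub ε hε ?_
      rw [Metric.mem_closedBall, dist_eq_norm, hh]
      simp only [add_sub_cancel_left, Complex.norm_real]
      rw [Real.norm_of_nonneg (by positivity)]
      exact div_le_self (by positivity) (by linarith [(Nat.cast_nonneg k : (0 : ℝ) ≤ k)])
    have hlim : Tendsto h atTop (𝓝[≠] ε) := by
      refine tendsto_nhdsWithin_iff.2 ⟨?_, Eventually.of_forall fun k => ?_⟩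
      · have h1 : Tendsto (fun k : ℕ => R / 4 / ((k : ℝ) + 1)) atTop (𝓝 0) := by
          have := (tendsto_one_div_add_atTop_nhds_zero_nat (𝕜 := ℝ)).const_mul (R / 4)
          simpa [div_eq_mul_inv] using this
        have h2 := ((Complex.continuous_ofReal.tendsto 0).comp h1).const_add ε
        simpa [hh, Function.comp_def] using h2
      · have : (R / 4 / ((k : ℝ) + 1)) ≠ 0 := by positivity
        simp only [hh, Set.mem_compl_iff, Set.mem_singleton_iff, add_eq_left]
        exact_mod_cast this
    refine aestronglyMeasurable_of_tendsto_ae atTop (f := fun k x => slope (fun ε => f ε x) ε (h k))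
      (fun k => ?_) ?_
    · simp only [slope_def_module]
      exact ((hmeas _ (hmem k)).sub (hmeas ε (Metric.ball_subset_ball (by linarith) hε))
        ).const_smul (h k - ε)⁻¹
    · filter_upwards [hderiv] with x hx
      exact (hasDerivAt_iff_tendsto_slope.1 (hx ε hε)).comp hlim
  refine ⟨hmeas', ?_⟩
  have hεR : ε ∈ Metric.ball (0 : ℂ) R := Metric.ball_subset_ball (by linarith) hε
  refine (hasDerivAt_integral_of_dominated_loc_of_deriv_le (bound := fun x => b x / (R / 4))
    (F' := fun ε x => deriv (fun ε => f ε x) ε)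
    (Metric.isOpen_ball.mem_nhds hε) ?_ ?_ hmeas' hbd (hb.div_const _) hderiv).2
  · filter_upwards [Metric.isOpen_ball.mem_nhds hεR] with z hz using hmeas z hz
  · exact hb.mono' (hmeas ε hεR) (hbound.mono fun x hx => hx ε hεR)

/-- Taylor expansion commutes with integration for a dominated family of holomorphic functions. -/
theorem iteratedDeriv_integral_of_holomorphic {X : Type*} [MeasurableSpace X] {μ : Measure X}
    (k : ℕ) {f : ℂ → X → ℂ} {b : X → ℝ} {R : ℝ} (hR : 0 < R) (hb : Integrable b μ)
    (hmeas : ∀ ε ∈ Metric.ball (0 : ℂ) R, AEStronglyMeasurable (f ε) μ)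
    (hdiff : ∀ᵐ x ∂μ, DifferentiableOn ℂ (fun ε => f ε x) (Metric.ball 0 R))
    (hbound : ∀ᵐ x ∂μ, ∀ ε ∈ Metric.ball (0 : ℂ) R, ‖f ε x‖ ≤ b x) :
    Integrable (fun x => iteratedDeriv k (fun ε => f ε x) 0) μ ∧
      iteratedDeriv k (fun ε => ∫ x, f ε x ∂μ) 0 =
        ∫ x, iteratedDeriv k (fun ε => f ε x) 0 ∂μ := by
  induction k generalizing f b R with
  | zero =>
    simp only [iteratedDeriv_zero, and_true]
    have h0 : (0 : ℂ) ∈ Metric.ball (0 : ℂ) R := Metric.mem_ball_self hR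
    exact hb.mono' (hmeas 0 h0) (hbound.mono fun x hx => hx 0 h0)
  | succ k ih =>
    obtain ⟨h1, h2⟩ := hasDerivAt_integral_of_holomorphic hR hb hmeas hdiff hbound
    have h3 := ih (f := fun ε x => deriv (fun ε => f ε x) ε) (half_pos hR) (hb.div_const (R / 4))
      (fun ε hε => (h2 ε hε).1) (hdiff.mono fun x hx =>
        (hx.deriv Metric.isOpen_ball).mono (Metric.ball_subset_ball (by linarith))) h1
    simp only [iteratedDeriv_succ']
    refine ⟨h3.1, ?_⟩
    rw [← h3.2]
    refine Filter.EventuallyEq.iteratedDeriv_eq k ?_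
    filter_upwards [Metric.ball_mem_nhds (0 : ℂ) (half_pos hR)] with ε hε
    exact (h2 ε hε).2.deriv

variable {n : ℕ}

theorem measurableSet_orthant (n : ℕ) : MeasurableSet (orthant n) := by
  rw [orthant, Set.ofPred_forall]
  exact MeasurableSet.iInter fun i => measurableSet_lt measurable_const (measurable_pi_apply i)

theorem ae_logMeasure_mem_orthant (n : ℕ) : ∀ᵐ α ∂(logMeasure n), α ∈ orthant n :=
  (withDensity_absolutelyContinuous _ _).ae_le (ae_restrict_mem (measurableSet_orthant n))

/-- The one-dimensional integral of `exp (-δ |log a|)` against `da/a` converges. -/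
theorem integrableOn_inv_mul_exp_neg_abs_log {δ : ℝ} (hδ : 0 < δ) :
    IntegrableOn (fun a : ℝ => a⁻¹ * Real.exp (-(δ * |Real.log a|))) (Set.Ioi 0) := by
  rw [← Set.Ioc_union_Ioi_eq_Ioi zero_le_one]
  refine IntegrableOn.union ?_ ?_
  · have h1 : IntegrableOn (fun a : ℝ => a ^ (δ - 1)) (Set.Ioc 0 1) :=
      (intervalIntegrable_iff_integrableOn_Ioc_of_le zero_le_one).1
        (intervalIntegral.intervalIntegrable_rpow' (by linarith))
    refine h1.congr_fun (fun a ha => ?_) measurableSet_Ioc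
    have hlog : Real.log a ≤ 0 := Real.log_nonpos ha.1.le ha.2
    simp only
    rw [abs_of_nonpos hlog, Real.rpow_sub_one ha.1.ne', Real.rpow_def_of_pos ha.1,
      div_eq_inv_mul]
    congr 2; ring
  · refine (integrableOn_Ioi_rpow_of_lt (a := -δ - 1) (by linarith) one_pos).congr_fun
      (fun a ha => ?_) measurableSet_Ioi
    have ha0 : (0 : ℝ) < a := one_pos.trans ha
    have hlog : 0 ≤ Real.log a := Real.log_nonneg (le_of_lt ha)
    simp only
    rw [abs_of_nonneg hlog, Real.rpow_sub_one ha0.ne', Real.rpow_def_of_pos ha0, div_eq_inv_mul]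
    congr 2; ring

theorem integrable_exp_neg_sum_abs_log (n : ℕ) {δ : ℝ} (hδ : 0 < δ) :
    Integrable (fun α : Fin n → ℝ => Real.exp (-(δ * ∑ i, |Real.log (α i)|))) (logMeasure n) := by
  have hm : Measurable fun α : Fin n → ℝ => ENNReal.ofReal (∏ i, (α i)⁻¹) := by fun_prop
  rw [logMeasure, integrable_withDensity_iff_integrable_smul' hm (by simp)]
  change IntegrableOn _ _ _
  rw [← integrable_indicator_iff (measurableSet_orthant n)]
  have h1 := Integrable.fintype_prod (μ := fun _ : Fin n => (volume : Measure ℝ))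
    (f := fun _ : Fin n => (Set.Ioi (0 : ℝ)).indicator
      fun a => a⁻¹ * Real.exp (-(δ * |Real.log a|)))
    fun i => (integrable_indicator_iff measurableSet_Ioi).2
      (integrableOn_inv_mul_exp_neg_abs_log hδ)
  refine h1.congr (Eventually.of_forall fun α => ?_)
  by_cases hα : α ∈ orthant n
  · simp only [Set.indicator_of_mem hα]
    rw [Finset.prod_congr rfl fun i _ => Set.indicator_of_mem (Set.mem_Ioi.2 (hα i)) _,
      Finset.prod_mul_distrib, ENNReal.toReal_ofReal
        (Finset.prod_nonneg fun i _ => inv_nonneg.2 (hα i).le), smul_eq_mul, ← Real.exp_sum,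
      Finset.sum_neg_distrib, Finset.mul_sum]
  · simp only [Set.indicator_of_notMem hα]
    simp only [orthant, Set.mem_ofPred_eq, not_forall] at hα
    obtain ⟨i, hi⟩ := hα
    exact Finset.prod_eq_zero (Finset.mem_univ i) (Set.indicator_of_notMem hi _)

variable {ι : Type*} [Fintype ι]

theorem expVec_log {α : Fin n → ℝ} (hα : α ∈ orthant n) :
    expVec (fun i => Real.log (α i)) = α :=
  funext fun i => Real.exp_log (hα i)

theorem measurable_combEval (s : ι → ℂ) (I : ι → EulerIntegrand n) (ε : ℂ) :
    Measurable (combEval s I ε) := by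
  have hpoly : ∀ P : Laurent n, Measurable P.eval := fun P => by
    unfold Laurent.eval Finsupp.sum
    fun_prop
  unfold combEval EulerIntegrand.eval EulerIntegrand.monomial
  refine Finset.measurable_sum _ fun i _ => Measurable.const_mul (Measurable.mul ?_ ?_) _
  · exact Finset.measurable_prod _ fun j _ =>
      (Complex.measurable_ofReal.comp (measurable_pi_apply j)).pow_const _
  · exact Finset.measurable_prod _ fun j _ =>
      (Complex.measurable_ofReal.comp (hpoly _)).pow_const _

theorem EulerIntegrand.eval_poly_pos (I : EulerIntegrand n) (j : Fin I.m) {α : Fin n → ℝ}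
    (hα : α ∈ orthant n) : 0 < (I.P j).eval α :=
  Finset.sum_pos (fun _ hm => mul_pos (I.coeff_pos hm)
    (Finset.prod_pos fun i _ => zpow_pos (hα i) _)) (I.support_nonempty j)

theorem differentiable_combEval (s : ι → ℂ) (I : ι → EulerIntegrand n) {α : Fin n → ℝ}
    (hα : α ∈ orthant n) : Differentiable ℂ fun ε => combEval s I ε α := by
  unfold combEval EulerIntegrand.eval EulerIntegrand.monomial
  refine Differentiable.fun_sum fun i _ => (Differentiable.mul ?_ ?_).const_mul _
  · refine Differentiable.fun_finsetProd fun j _ => Differentiable.const_cpow (by fun_prop) ?_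
    exact Or.inl (by exact_mod_cast (hα j).ne')
  · refine Differentiable.fun_finsetProd fun j _ => Differentiable.const_cpow (by fun_prop) ?_
    exact Or.inl (by exact_mod_cast ((I i).eval_poly_pos j hα).ne')

/-- Uniform exponential decay in logarithmic coordinates implies local finiteness. -/
theorem locallyFinite_combEval_of_bound (s : ι → ℂ) (I : ι → EulerIntegrand n) {δ C : ℝ}
    (hδ : 0 < δ) (h : ∀ᶠ ε in 𝓝 (0 : ℂ), ∀ x : Fin n → ℝ,
      ‖combEval s I ε (expVec x)‖ ≤ C * Real.exp (-(δ * ∑ i, |x i|))) :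
    LocallyFinite (combEval s I) := by
  obtain ⟨R, hR, hball⟩ := Metric.eventually_nhds_iff_ball.1 h
  have hb := (integrable_exp_neg_sum_abs_log n hδ).const_mul C
  have hmeas : ∀ ε ∈ Metric.ball (0 : ℂ) R,
      AEStronglyMeasurable (combEval s I ε) (logMeasure n) :=
    fun ε _ => (measurable_combEval s I ε).aestronglyMeasurable
  have hdiff : ∀ᵐ α ∂(logMeasure n),
      DifferentiableOn ℂ (fun ε => combEval s I ε α) (Metric.ball 0 R) := by
    filter_upwards [ae_logMeasure_mem_orthant n] with α hα
    exact (differentiable_combEval s I hα).differentiableOn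
  have hbound : ∀ᵐ α ∂(logMeasure n), ∀ ε ∈ Metric.ball (0 : ℂ) R,
      ‖combEval s I ε α‖ ≤ C * Real.exp (-(δ * ∑ i, |Real.log (α i)|)) := by
    filter_upwards [ae_logMeasure_mem_orthant n] with α hα ε hε
    have := hball ε hε fun i => Real.log (α i)
    rwa [expVec_log hα] at this
  refine ⟨?_, ?_, fun k => iteratedDeriv_integral_of_holomorphic k hR hb hmeas hdiff hbound⟩
  · filter_upwards [Metric.ball_mem_nhds (0 : ℂ) hR] with ε hε
    exact hb.mono' (hmeas ε hε) (hbound.mono fun α hα => hα ε hε)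
  · have h1 := (hasDerivAt_integral_of_holomorphic hR hb hmeas hdiff hbound).2
    have h2 : DifferentiableOn ℂ (fun ε => ∫ α, combEval s I ε α ∂(logMeasure n))
        (Metric.ball 0 (R / 2)) :=
      fun ε hε => (h1 ε hε).2.differentiableAt.differentiableWithinAt
    exact h2.analyticAt (Metric.ball_mem_nhds _ (half_pos hR))

end

end EulerInt

end

theorem mainTheorem2 (n : ℕ) {ι : Type*} [Fintype ι] (s : ι → ℂ)
    (I : ι → EulerInt.EulerIntegrand n)
    (hpointed : EulerInt.FanPointed (EulerInt.combFan I)) :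
    (EulerInt.fanDim (EulerInt.combFan I) 1).Finite ∧
    ((∀ σ ∈ EulerInt.fanDim (EulerInt.combFan I) 1, ∀ ρ : Fin n → ℤ, ρ ≠ 0 →
        (fun i => (ρ i : ℝ)) ∈ σ → EulerInt.NegLeading (EulerInt.trop s I ρ)) →
      EulerInt.LocallyFinite (EulerInt.combEval s I)) := by
  refine ⟨(EulerInt.finite_combFan I).subset fun σ hσ => hσ.1, fun hneg => ?_⟩
  obtain ⟨δ, hδ, C, h⟩ := EulerInt.exists_uniform_bound s I hpointed hneg
  exact EulerInt.locallyFinite_combEval_of_bound s I hδ h
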